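/- **Conventions.** Let $\mathbb{I}$ be the $7$-dimensional space of imaginary split octonions, i.e. the orthogonal complement of $1$ for the bilinear form $\langle\cdot,\cdot\rangle$ that polarizes the multiplicative quadratic form $N$ of the split octonions ($\langle x,x\rangle=N(x)$), with the product $x\times y := xy+\langle x,y\rangle 1$. A *$G_2$-structure* on a real $7$-dimensional vector space $\mathbb{V}$ is a bilinear map $\times:\mathbb{V}\times\mathbb{V}\to\mathbb{V}$ isomorphic, by a linear isomorphism $\mathbb{I}\to\mathbb{V}$, to the product $\times$ on $\mathbb{I}$; equivalently, it is the $3$-form $\Phi(x,y,z):=H_\Phi(x\times y,z)$, where $H_\Phi(x,y):=-\tfrac16\operatorname{tr}(x\times(y\times\,\cdot\,))$, a symmetric bilinear form of signature $(3,4)$. It induces the volume form $$\epsilon_\Phi:=\tfrac1{42}\sum_K (E_K\lrcorner\Phi)\wedge(E^K\lrcorner\Phi)\wedge\Phi ,$$ where $(E_K)$ is any basis and $(E^K)$ its $H_\Phi$-dual basis, the orientation $[\epsilon_\Phi]$, and the Hodge star $*_\Phi$ of $(H_\Phi,\epsilon_\Phi)$. For $\mathbb{S}\in\mathbb{V}$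 put $\mathbb{S}^\flat:=H_\Phi(\mathbb{S},\,\cdot\,)$ and $$\Phi_I:=\mathbb{S}\lrcorner(\mathbb{S}^\flat\wedge\Phi),\qquad \Phi_J:=\mathbb{S}\lrcorner *_\Phi\Phi .$$ **Proposition 4.1.** Let $\mathbb{V}$ be a $7$-dimensional real vector space and fix a $G_2$-structure $\Phi\in\Lambda^3\mathbb{V}^*$. 1. Every nonzero $\mathbb{S}\in\mathbb{V}$ has a positive multiple with $\varepsilon:=-H_\Phi(\mathbb{S},\mathbb{S})\in\{-1,0,+1\}$. Fix a nonzero vector $\mathbb{S}$ so normalized. For any $(\bar A,B)\in\mathbb{R}^2$ with $-\varepsilon\bar A^2+2\bar A+B^2=0$ the $3$-form $$\Phi':=\Phi+\bar A\,\Phi_I+B\,\Phi_J$$ is a $G_2$-structure with $(H_{\Phi'},[\epsilon_{\Phi'}])=(H_\Phi,[\epsilon_\Phi])$. Such pairs form a $1$-parameter family: they are the pairs $(\cos t-1,\sin t)$ if $\varepsilon=-1$, the pairs $(-\tfrac12t^2,t)$ if $\varepsilon=0$, and the pairs $(1\mp\cosh t,\sinh t)$ if $\varepsilon=+1$, with $t\in\mathbb{R}$.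 2. Conversely, if a $G_2$-structure $\Phi'$ on $\mathbb{V}$ satisfies $(H_{\Phi'},[\epsilon_{\Phi'}])=(H_\Phi,[\epsilon_\Phi])$, then there are a nonzero vector $\mathbb{S}\in\mathbb{V}$ with $\varepsilon:=-H_\Phi(\mathbb{S},\mathbb{S})\in\{-1,0,+1\}$ and $(\bar A,B)\in\mathbb{R}^2$ with $-\varepsilon\bar A^2+2\bar A+B^2=0$ such that $\Phi'=\Phi+\bar A\,\Phi_I+B\,\Phi_J$. -/

import Mathlib

open scoped Quaternion

/-! ### Split octonions

The split octonions are realised, by the Cayley-Dickson construction with sign `+1`, on pairs of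
real quaternions, with `(a, b)(c, d) = (ac + d̄b, da + bc̄)`, unit `(1, 0)` and
multiplicative quadratic form `N(a, b) = |a|² - |b|²`. -/

/-- The product of split octonions. -/
noncomputable def octMul (x y : ℍ[ℝ] × ℍ[ℝ]) : ℍ[ℝ] × ℍ[ℝ] :=
  (x.1 * y.1 + star y.2 * x.2, y.2 * x.1 + x.2 * star y.1)

/-- The polarisation of the quadratic form `N(a, b) = |a|² - |b|²`, a symmetric bilinear form of
signature `(4, 4)` with `octInner x x = N x`. -/
noncomputable def octInner (x y : ℍ[ℝ] × ℍ[ℝ]) : ℝ :=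
  (x.1 * star y.1).re - (x.2 * star y.2).re

/-- The imaginary split octonions: the orthogonal complement of the unit `(1, 0)`. -/
def octIm : Submodule ℝ (ℍ[ℝ] × ℍ[ℝ]) where
  carrier := {x | octInner (1, 0) x = 0}
  add_mem' := by
    intro x y hx hy
    simp [octInner] at hx hy ⊢
    rw [hx, hy, add_zero]
  zero_mem' := by simp [octInner]
  smul_mem' := by
    intro c x hx
    simp [octInner] at hx ⊢
    exact Or.inr hx

/-- The cross product `x × y = xy + ⟨x, y⟩ 1` of imaginary split octonions. -/
noncomputable def octCross (x y : octIm) : octIm :=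
  ⟨octMul x y + octInner x y • ((1, 0) : ℍ[ℝ] × ℍ[ℝ]), by
    obtain ⟨x, hx⟩ := x
    obtain ⟨y, hy⟩ := y
    change octInner (1, 0) x = 0 at hx
    change octInner (1, 0) y = 0 at hy
    change octInner (1, 0) _ = 0
    simp [octInner, octMul] at hx hy ⊢
    rw [hx, hy]
    ring⟩

section

variable {V : Type*} [AddCommGroup V] [Module ℝ V]

/-! ### Split cross products and the structures they induce -/

/-- A bilinear map `V × V → V` is a split cross product if it is isomorphic to the cross product
of the imaginary split octonions. -/
def IsSplitCrossProduct (m : V →ₗ[ℝ] V →ₗ[ℝ] V) : Prop :=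
  ∃ A : octIm ≃ₗ[ℝ] V, ∀ x y : octIm, A (octCross x y) = m (A x) (A y)

/-- The bilinear form `H(x, y) = -(1/6) tr(z ↦ x × (y × z))` of a cross product. -/
noncomputable def crossMetric (m : V →ₗ[ℝ] V →ₗ[ℝ] V) : LinearMap.BilinForm ℝ V :=
  LinearMap.mk₂ ℝ (fun x y => -(1 / 6) * LinearMap.trace ℝ V (m x ∘ₗ m y))
    (by intro x x' y; simp [LinearMap.add_comp, mul_add])
    (by intro c x y; simp [LinearMap.smul_comp]; ring)
    (by intro x y y'; simp [LinearMap.comp_add, mul_add])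
    (by intro c x y; simp [LinearMap.comp_smul]; ring)

/-- The multilinear map
`(v₀, …, v₆) ↦ H(v₀ × v₁, v₂ × v₃) H(v₄ × v₅, v₆)`. In index notation, with
`Φ(x, y, z) = H(x × y, z)`, this is the tensor `Φ_{KAB} Φ^K_{CD} Φ_{EFG}`. -/
noncomputable def crossTensor (m : V →ₗ[ℝ] V →ₗ[ℝ] V) :
    MultilinearMap ℝ (fun _ : Fin 7 => V) ℝ where
  toFun v := crossMetric m (m (v 0) (v 1)) (m (v 2) (v 3)) * crossMetric m (m (v 4) (v 5)) (v 6)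
  map_update_add' := by
    intro inst v i x y
    fin_cases i <;> simp [Fin.ext_iff] <;> ring
  map_update_smul' := by
    intro inst v i c x
    fin_cases i <;> simp [Fin.ext_iff] <;> ring

/-- The volume form of a cross product, `ε = (1/42) ∑_K (E_K ⌟ Φ) ∧ (E^K ⌟ Φ) ∧ Φ`, where
`(E_K)` is a basis and `(E^K)` is its `H`-dual basis. The factor `1/24 = 1/(2! 2! 3!)` turns the
sum over all permutations into the wedge product. -/
noncomputable def crossVol (m : V →ₗ[ℝ] V →ₗ[ℝ] V) : V [⋀^Fin 7]→ₗ[ℝ] ℝ :=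
  ((1 / 42 : ℝ) * (1 / 24)) • MultilinearMap.alternatization (crossTensor m)

/-! ### Exterior algebra of forms -/

/-- The wedge product `θ ∧ ω` of a linear form `θ` and an `n`-form `ω`, given by
`(θ ∧ ω)(v₀, …, vₙ) = ∑ i, (-1)^i θ(vᵢ) ω(v₀, …, v̂ᵢ, …, vₙ)`. -/
noncomputable def wedgeOne {n : ℕ} (θ : V →ₗ[ℝ] ℝ) (ω : V [⋀^Fin n]→ₗ[ℝ] ℝ) :
    V [⋀^Fin (n + 1)]→ₗ[ℝ] ℝ :=
  AlternatingMap.alternatizeUncurryFin (θ.smulRight ω)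

/-- The contraction `S ⌟ ω = ω(S, ·, …, ·)`. -/
def hook {n : ℕ} (S : V) (ω : V [⋀^Fin (n + 1)]→ₗ[ℝ] ℝ) : V [⋀^Fin n]→ₗ[ℝ] ℝ :=
  AlternatingMap.curryLeft ω S

/-- The vector `b^i = ∑ j, G^{ij} b_j`, where `(G^{ij})` is the inverse of the Gram matrix
`(H(b_i, b_j))`. If `H` is nondegenerate these vectors form the `H`-dual basis of `b`. -/
noncomputable def raisedBasis {ι : Type*} [Fintype ι] [DecidableEq ι]
    (H : LinearMap.BilinForm ℝ V) (b : Module.Basis ι ℝ V) (i : ι) : V :=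
  ∑ j, (LinearMap.BilinForm.toMatrix b H)⁻¹ i j • b j

/-- The Hodge star of a `3`-form in dimension `7` with respect to a metric `H` and a volume
form `ε`: in index notation `(*β)_{DEFG} = (1/3!) β^{ABC} ε_{ABCDEFG}`. The right-hand side does
not depend on the basis in which it is evaluated. -/
noncomputable def hodgeStarThree [FiniteDimensional ℝ V] (H : LinearMap.BilinForm ℝ V)
    (ε : V [⋀^Fin 7]→ₗ[ℝ] ℝ) (β : V [⋀^Fin 3]→ₗ[ℝ] ℝ) : V [⋀^Fin 4]→ₗ[ℝ] ℝ :=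
  let b := Module.finBasis ℝ V
  (1 / 6 : ℝ) • ∑ i, ∑ j, ∑ k,
    β ![raisedBasis H b i, raisedBasis H b j, raisedBasis H b k] •
      hook (b k) (hook (b j) (hook (b i) ε))

end

/-! ### Split `G₂`-structures -/

/-- A (split) `G₂`-structure on `V`: a split cross product `×` together with the `3`-form
`Φ(x, y, z) = H(x × y, z)` that it determines. -/
structure G2Structure (V : Type*) [AddCommGroup V] [Module ℝ V] where
  /-- The `3`-form. -/
  form : V [⋀^Fin 3]→ₗ[ℝ] ℝ
  /-- The cross product. -/
  cross : V →ₗ[ℝ] V →ₗ[ℝ] V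
  isSplit : IsSplitCrossProduct cross
  form_apply : ∀ x y z : V, form ![x, y, z] = crossMetric cross (cross x y) z

namespace G2Structure

variable {V : Type*} [AddCommGroup V] [Module ℝ V]

/-- The bilinear form `H_Φ`. -/
noncomputable def metric (Φ : G2Structure V) : LinearMap.BilinForm ℝ V := crossMetric Φ.cross

/-- The volume form `ε_Φ`. -/
noncomputable def vol (Φ : G2Structure V) : V [⋀^Fin 7]→ₗ[ℝ] ℝ := crossVol Φ.cross

/-- Two `G₂`-structures induce the same metric and the same orientation. -/
def SameMetricOrientation (Φ Φ' : G2Structure V) : Prop :=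
  Φ'.metric = Φ.metric ∧ ∃ c : ℝ, 0 < c ∧ Φ'.vol = c • Φ.vol

/-- `Φ_I = S ⌟ (S♭ ∧ Φ)`, where `S♭ = H_Φ(S, ·)`. -/
noncomputable def formI (Φ : G2Structure V) (S : V) : V [⋀^Fin 3]→ₗ[ℝ] ℝ :=
  hook S (wedgeOne (Φ.metric S) Φ.form)

/-- `Φ_J = S ⌟ *Φ`, where `*` is the Hodge star of `H_Φ` and `ε_Φ`. -/
noncomputable def formJ [FiniteDimensional ℝ V] (Φ : G2Structure V) (S : V) :
    V [⋀^Fin 3]→ₗ[ℝ] ℝ :=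
  hook S (hodgeStarThree Φ.metric Φ.vol Φ.form)

end G2Structure

/-! ### Cross products and spinors -/

/-! The structures compatible with `Φ` correspond to non-null spinors up to scale. On ℝ × V a vector
x acts by Clifford multiplication, x·x = -H(x, x), and a non-null spinor u defines Φ_u(x, y, z) =
-⟨x·y·z·u, u⟩ / ⟨u, u⟩. The spinor (1, 0) gives back `Φ`. Expanding for u = (a, s), with N = a² +
H(s, s), yields Φ_u = Φ - (2/N) Φ_I - (2a/N) Φ_J, where Φ_I and Φ_J are formed with s
(`spinForm_eq`, `spinForm_eq_form`). The coefficients satisfy the quadratic relation identically.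

Reflections link the two sides: pulling Φ_u back along the reflection in v^⊥ gives -Φ_{v·u}
(`spinForm_hyperplaneReflection`). For an admissible pair with A ≠ 0, the spinor (B/A, S) has norm
-2/A and equals v·w·(1, 0) for non-null v, w, so its form is the pullback of `Φ` by a product of two
reflections. That map is an isometry of determinant 1, whence compatibility. Conversely, a
compatible structure is the image of `Φ` under an isometry of positive determinant. By the
Cartan-Dieudonné argument (`isometry_induction`) this is a product of reflections, evenly many by
the determinant, so the new form is some Φ_u; rescaling s gives S.

It remains to identify the objects defined by traces and sums. The trace metric follows from the
contraction identity (`IsCross.crossMetric_eq`). The volume form and *Φ are computed in an adapted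
basis from finite integer identities; there *Φ becomes `crossFour`. -/

section Spinors

variable {V : Type*} [AddCommGroup V] [Module ℝ V]

/-- The identities satisfied by a seven-dimensional cross product `m` with metric `H`. -/
structure IsCross (H : LinearMap.BilinForm ℝ V) (m : V →ₗ[ℝ] V →ₗ[ℝ] V) : Prop where
  symm : ∀ x y, H x y = H y x
  self : ∀ x, m x x = 0
  adj : ∀ x y z, H (m x y) z = H x (m y z)
  contr : ∀ x y, m x (m x y) = -(H x x) • y + H x y • x

namespace IsCross

variable {H : LinearMap.BilinForm ℝ V} {m : V →ₗ[ℝ] V →ₗ[ℝ] V}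

theorem antisymm (h : IsCross H m) (x y : V) : m x y = -m y x := by
  have := h.self (x + y)
  simp only [map_add, LinearMap.add_apply, h.self] at this
  rw [zero_add, add_zero] at this
  exact eq_neg_of_add_eq_zero_right this

theorem skew (h : IsCross H m) (x y z : V) : H (m x y) z = -H y (m x z) := by
  rw [h.antisymm x y, map_neg, LinearMap.neg_apply, h.adj]

/-- Polarization of `contr` in its repeated argument; its trace later determines the metric. -/
theorem contr_polar (h : IsCross H m) (x z y : V) :
    m x (m z y) + m z (m x y) = -(2 * H x z) • y + H x y • z + H z y • x := by
  have e := h.contr (x + z) y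
  simp only [map_add, LinearMap.add_apply, h.contr, h.symm z x] at e
  have e' : m x (m z y) + m z (m x y) =
      (-(H x x) • y + H x y • x + m z (m x y) + (m x (m z y) + (-(H z z) • y + H z y • z)))
      - (-(H x x) • y + H x y • x) - (-(H z z) • y + H z y • z) := by abel
  rw [e']
  rw [show -(H x x) • y + H x y • x + m z (m x y) + (m x (m z y) + (-(H z z) • y + H z y • z)) =
    -(H x x + H x z + (H x z + H z z)) • y + (H x y + H z y) • (x + z) by
      rw [← e]]
  module

end IsCross

/-- Clifford multiplication of a vector on a spinor `(a, w) : ℝ × V`. -/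
noncomputable def cliffordMul (H : LinearMap.BilinForm ℝ V) (m : V →ₗ[ℝ] V →ₗ[ℝ] V) :
    V →ₗ[ℝ] (ℝ × V) →ₗ[ℝ] (ℝ × V) :=
  LinearMap.mk₂ ℝ (fun x p => (-H x p.2, p.1 • x + m x p.2))
    (by intro x x' p; ext <;> simp <;> first | ring1 | module)
    (by intro c x p; ext <;> simp <;> module)
    (by intro x p p'; ext <;> simp <;> first | ring1 | module)
    (by intro c x p; ext <;> simp <;> module)

/-- The quadratic pairing of spinors. -/
noncomputable def spinInner (H : LinearMap.BilinForm ℝ V) : LinearMap.BilinForm ℝ (ℝ × V) :=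
  LinearMap.mk₂ ℝ (fun p q => p.1 * q.1 + H p.2 q.2)
    (by intro x x' p; simp; ring)
    (by intro c x p; simp; ring)
    (by intro x p p'; simp; ring)
    (by intro c x p; simp; ring)

/-- The three-form determined by a non-null spinor. -/
noncomputable def spinForm (H : LinearMap.BilinForm ℝ V) (m : V →ₗ[ℝ] V →ₗ[ℝ] V) (u : ℝ × V)
    (x y z : V) : ℝ :=
  -spinInner H (cliffordMul H m x (cliffordMul H m y (cliffordMul H m z u))) u / spinInner H u u

/-- The four-form `H(s × x, y × z) - H(s, y) H(x, z) + H(s, z) H(x, y)` of a cross product. -/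
def crossFour (H : LinearMap.BilinForm ℝ V) (m : V →ₗ[ℝ] V →ₗ[ℝ] V) (s x y z : V) : ℝ :=
  H (m s x) (m y z) - H s y * H x z + H s z * H x y

section

variable (H : LinearMap.BilinForm ℝ V) (m : V →ₗ[ℝ] V →ₗ[ℝ] V)

theorem cliffordMul_apply (x : V) (p : ℝ × V) :
    cliffordMul H m x p = (-H x p.2, p.1 • x + m x p.2) := rfl

theorem spinInner_apply (p q : ℝ × V) : spinInner H p q = p.1 * q.1 + H p.2 q.2 := rfl

end

namespace IsCross

variable {H : LinearMap.BilinForm ℝ V} {m : V →ₗ[ℝ] V →ₗ[ℝ] V}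

theorem cliffordMul_self (h : IsCross H m) (x : V) (p : ℝ × V) :
    cliffordMul H m x (cliffordMul H m x p) = -(H x x) • p := by
  have h1 : H x (m x p.2) = 0 := by rw [← h.adj, h.self]; simp
  ext
  · simp [cliffordMul_apply, h1]; ring
  · simp [cliffordMul_apply, h.self, h.contr]

theorem cliffordMul_anticomm (h : IsCross H m) (x y : V) (p : ℝ × V) :
    cliffordMul H m x (cliffordMul H m y p) =
      -cliffordMul H m y (cliffordMul H m x p) - (2 * H x y) • p := by
  have e := h.cliffordMul_self (x + y) p
  simp only [map_add, LinearMap.add_apply, h.cliffordMul_self, h.symm y x] at e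
  rw [show cliffordMul H m x (cliffordMul H m y p) =
    (-(H x x) • p + cliffordMul H m y (cliffordMul H m x p) +
      (cliffordMul H m x (cliffordMul H m y p) + -(H y y) • p)) + (H x x) • p + (H y y) • p
      - cliffordMul H m y (cliffordMul H m x p) by module, e]
  module

theorem spinInner_cliffordMul (h : IsCross H m) (x : V) (p q : ℝ × V) :
    spinInner H (cliffordMul H m x p) q = -spinInner H p (cliffordMul H m x q) := by
  simp only [spinInner_apply, cliffordMul_apply, map_add, map_smul, LinearMap.add_apply,
    LinearMap.smul_apply, smul_eq_mul, h.skew x, h.symm p.2 x]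
  ring

theorem spinInner_cliffordMul_cliffordMul (h : IsCross H m) (x : V) (p q : ℝ × V) :
    spinInner H (cliffordMul H m x p) (cliffordMul H m x q) = H x x * spinInner H p q := by
  rw [h.spinInner_cliffordMul, h.cliffordMul_self]
  simp

end IsCross

/-! ### Reflections -/

/-- The reflection in the hyperplane orthogonal to a non-null vector. -/
noncomputable def hyperplaneReflection (H : LinearMap.BilinForm ℝ V) (v : V) (hv : H v v ≠ 0) :
    V ≃ₗ[ℝ] V :=
  Module.reflection (x := v) (f := (2 / H v v) • H v) (by simp [hv])

variable {H : LinearMap.BilinForm ℝ V} {m : V →ₗ[ℝ] V →ₗ[ℝ] V}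

theorem hyperplaneReflection_apply (v : V) (hv : H v v ≠ 0) (x : V) :
    hyperplaneReflection H v hv x = x - (2 / H v v * H v x) • v := by
  simp [hyperplaneReflection, Module.reflection_apply]

theorem hyperplaneReflection_hyperplaneReflection (v : V) (hv : H v v ≠ 0) (x : V) :
    hyperplaneReflection H v hv (hyperplaneReflection H v hv x) = x :=
  Module.involutive_reflection _ x

theorem hyperplaneReflection_isometry (hs : ∀ x y, H x y = H y x) (v : V) (hv : H v v ≠ 0)
    (x y : V) :
    H (hyperplaneReflection H v hv x) (hyperplaneReflection H v hv y) = H x y := by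
  simp only [hyperplaneReflection_apply, map_sub, map_smul, LinearMap.sub_apply,
    LinearMap.smul_apply, smul_eq_mul, hs x v]
  field_simp
  ring

/-- A map x ↦ x + f(x) v has determinant 1 + f(v), and here f(v) = -2. -/
theorem det_hyperplaneReflection [FiniteDimensional ℝ V] (v : V) (hv : H v v ≠ 0) :
    LinearMap.det (hyperplaneReflection H v hv : V →ₗ[ℝ] V) = -1 := by
  have : (hyperplaneReflection H v hv : V →ₗ[ℝ] V) =
      LinearMap.transvection (-((2 / H v v) • H v)) v := by
    ext x
    simp [hyperplaneReflection_apply, LinearMap.transvection.apply, sub_eq_add_neg]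
  rw [this, LinearMap.transvection.det]
  simp [hv]
  norm_num

/-- Every isometry of a space with an orthogonal basis of non-null vectors is a product of
hyperplane reflections, phrased as an induction principle. -/
theorem isometry_induction {n : ℕ} (hs : ∀ x y, H x y = H y x) (b : Module.Basis (Fin n) ℝ V)
    (hb : ∀ i j, i ≠ j → H (b i) (b j) = 0) (hb' : ∀ i, H (b i) (b i) ≠ 0)
    (P : (V ≃ₗ[ℝ] V) → Prop) (refl : P (LinearEquiv.refl ℝ V))
    (step : ∀ (v : V) (hv : H v v ≠ 0) (f : V ≃ₗ[ℝ] V), P f →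
      P (f.trans (hyperplaneReflection H v hv)))
    (f : V ≃ₗ[ℝ] V) (hf : ∀ x y, H (f x) (f y) = H x y) : P f := by
  -- Reflections are involutions, so `P` may also be cancelled backwards through a reflection.
  have step' : ∀ (v : V) (hv : H v v ≠ 0) (f : V ≃ₗ[ℝ] V),
      P (f.trans (hyperplaneReflection H v hv)) → P f := by
    intro v hv f hP
    have := step v hv _ hP
    rwa [show (f.trans (hyperplaneReflection H v hv)).trans (hyperplaneReflection H v hv) = f by
      ext x; simp [hyperplaneReflection_hyperplaneReflection]] at this
  suffices key : ∀ k : ℕ, k ≤ n → ∀ f : V ≃ₗ[ℝ] V, (∀ x y, H (f x) (f y) = H x y) →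
      (∀ i : Fin n, k ≤ (i : ℕ) → f (b i) = b i) → P f from
    key n le_rfl f hf fun i hi => absurd i.2 (not_lt.2 hi)
  intro k
  induction k with
  | zero =>
    intro _ f _ hfix
    rwa [show f = LinearEquiv.refl ℝ V from b.ext' fun i => by simp [hfix i (Nat.zero_le _)]]
  | succ k ih =>
    intro hk f hf hfix
    let i₀ : Fin n := ⟨k, hk⟩
    have horth : ∀ i : Fin n, k + 1 ≤ (i : ℕ) → H (f (b i₀)) (b i) = 0 ∧ H (b i₀) (b i) = 0 := by
      intro i hi
      have hne : i₀ ≠ i := by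
        intro e
        have : (i₀ : ℕ) = i := congrArg Fin.val e
        simp only [i₀] at this
        omega
      refine ⟨?_, hb _ _ hne⟩
      conv_lhs => rw [← hfix i hi]
      rw [hf, hb _ _ hne]
    have hnorm := hf (b i₀) (b i₀)
    have hsym := hs (f (b i₀)) (b i₀)
    by_cases hd : H (f (b i₀) - b i₀) (f (b i₀) - b i₀) = 0
    -- The norms of f(b) - b and f(b) + b add up to 4 H(b, b) ≠ 0, so they cannot both be null. If
    -- the difference is null, reflecting in the sum sends f(b) to -b, and reflecting in b corrects
    -- the sign. All these vectors are orthogonal to the basis vectors already fixed.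
    · have hd' : H (f (b i₀) + b i₀) (f (b i₀) + b i₀) ≠ 0 := by
        intro h0
        simp only [map_add, map_sub, LinearMap.add_apply, LinearMap.sub_apply] at hd h0
        apply hb' i₀
        linarith
      apply step' _ hd'
      apply step' _ (hb' i₀)
      apply ih (by omega)
      · intro x y
        simp [hyperplaneReflection_isometry hs, hf]
      · intro i hi
        rcases Nat.lt_or_ge k i with hlt | hge
        · simp [hyperplaneReflection_apply, hfix i hlt, (horth i hlt).1, (horth i hlt).2]
        · obtain rfl : i = i₀ := Fin.ext (le_antisymm hge hi)
          have e1 : hyperplaneReflection H _ hd' (f (b i₀)) = -b i₀ := by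
            rw [hyperplaneReflection_apply]
            rw [show 2 / H (f (b i₀) + b i₀) (f (b i₀) + b i₀) * H (f (b i₀) + b i₀) (f (b i₀)) = 1
              by
                rw [div_mul_eq_mul_div, div_eq_one_iff_eq hd']
                simp only [map_add, LinearMap.add_apply]
                linarith]
            module
          have e2 : hyperplaneReflection H _ (hb' i₀) (b i₀) = -b i₀ := by
            rw [hyperplaneReflection_apply, div_mul_cancel₀ _ (hb' i₀)]
            module
          simp [e1, e2]
    · apply step' _ hd
      apply ih (by omega)
      · intro x y
        simp [hyperplaneReflection_isometry hs, hf]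
      · intro i hi
        rcases Nat.lt_or_ge k i with hlt | hge
        · simp [hyperplaneReflection_apply, hfix i hlt, (horth i hlt).1, (horth i hlt).2]
        · obtain rfl : i = i₀ := Fin.ext (le_antisymm hge hi)
          rw [LinearEquiv.trans_apply, hyperplaneReflection_apply,
            show 2 / H (f (b i₀) - b i₀) (f (b i₀) - b i₀) * H (f (b i₀) - b i₀) (f (b i₀)) = 1
              by
                rw [div_mul_eq_mul_div, div_eq_one_iff_eq hd]
                simp only [map_sub, LinearMap.sub_apply]
                linarith]
          module

/-! ### The three-forms of spinors -/

namespace IsCross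

/-- In the Clifford algebra, conjugation by v is minus the reflection in the hyperplane orthogonal
to v. -/
theorem cliffordMul_hyperplaneReflection (h : IsCross H m) (v : V) (hv : H v v ≠ 0) (x : V)
    (u : ℝ × V) :
    cliffordMul H m (hyperplaneReflection H v hv x) (cliffordMul H m v u) =
      -cliffordMul H m v (cliffordMul H m x u) := by
  rw [hyperplaneReflection_apply, map_sub, map_smul, LinearMap.sub_apply, LinearMap.smul_apply,
    h.cliffordMul_self, h.cliffordMul_anticomm x v, h.symm x v, smul_smul]
  rw [show 2 / H v v * H v x * -(H v v) = -(2 * H v x) by field_simp]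
  module

theorem cliffordMul_of_hyperplaneReflection (h : IsCross H m) (v : V) (hv : H v v ≠ 0) (x : V)
    (u : ℝ × V) :
    cliffordMul H m x (cliffordMul H m v u) =
      -cliffordMul H m v (cliffordMul H m (hyperplaneReflection H v hv x) u) := by
  rw [← h.cliffordMul_hyperplaneReflection v hv, hyperplaneReflection_hyperplaneReflection]

/-- Three sign changes from moving v to the left leave one minus sign, and the factor H(v, v)
cancels between numerator and denominator. -/
theorem spinForm_hyperplaneReflection (h : IsCross H m) (v : V) (hv : H v v ≠ 0) (u : ℝ × V)
    (x y z : V) :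
    spinForm H m u (hyperplaneReflection H v hv x) (hyperplaneReflection H v hv y)
      (hyperplaneReflection H v hv z) = -spinForm H m (cliffordMul H m v u) x y z := by
  rw [spinForm, spinForm, h.cliffordMul_of_hyperplaneReflection v hv z, map_neg,
    h.cliffordMul_of_hyperplaneReflection v hv y, neg_neg,
    h.cliffordMul_of_hyperplaneReflection v hv x, map_neg, LinearMap.neg_apply,
    h.spinInner_cliffordMul_cliffordMul, h.spinInner_cliffordMul_cliffordMul]
  field_simp

/-- Moving s to the front lets it be absorbed by the pairing in `spinForm_eq`, leaving only products
applied to (1, 0). -/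
theorem cliffordMul_move (h : IsCross H m) (x y z s : V) (p : ℝ × V) :
    cliffordMul H m x (cliffordMul H m y (cliffordMul H m z (cliffordMul H m s p))) =
      -cliffordMul H m s (cliffordMul H m x (cliffordMul H m y (cliffordMul H m z p)))
      - (2 * H s x) • cliffordMul H m y (cliffordMul H m z p)
      + (2 * H s y) • cliffordMul H m x (cliffordMul H m z p)
      - (2 * H s z) • cliffordMul H m x (cliffordMul H m y p) := by
  rw [h.cliffordMul_anticomm z s, map_sub, map_neg, h.cliffordMul_anticomm y s, map_sub, map_neg,
    map_sub, map_neg, h.cliffordMul_anticomm x s, map_smul, map_smul, map_smul, h.symm z s,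
    h.symm y s, h.symm x s]
  module

theorem crossFour_eq (h : IsCross H m) (s x y z : V) :
    crossFour H m s x y z = H (m x (m y z)) s - H s y * H x z + H s z * H x y := by
  rw [crossFour, h.adj, h.symm]

theorem spinForm_eq (h : IsCross H m) (a : ℝ) (s : V) (hu : a ^ 2 + H s s ≠ 0) (x y z : V) :
    spinForm H m (a, s) x y z = H (m x y) z
      - 2 / (a ^ 2 + H s s) * (H s s * H (m x y) z - H s x * H (m s y) z + H s y * H (m s x) z
          - H s z * H (m s x) y)
      - 2 * a / (a ^ 2 + H s s) * crossFour H m s x y z := by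
  have hN : spinInner H (a, s) (a, s) = a ^ 2 + H s s := by simp [spinInner_apply]; ring
  -- Every spinor is (a + s)·(1, 0), so the form of (a, s) expands into pairings of products of
  -- vectors applied to (1, 0).
  have h1 : ((a, s) : ℝ × V) = a • (1, 0) + cliffordMul H m s (1, 0) := by
    ext <;> simp [cliffordMul_apply]
  set o : ℝ × V := (1, 0) with ho
  have t : ∀ x y z : V, spinInner H (cliffordMul H m x (cliffordMul H m y (cliffordMul H m z o))) o
      = -H (m x y) z := by
    intro x y z
    simp [spinInner_apply, cliffordMul_apply, ho, h.adj]
  have t' : spinInner H (cliffordMul H m x (cliffordMul H m y (cliffordMul H m z o)))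
      (cliffordMul H m s o) = crossFour H m s x y z - H s x * H y z + H s y * H x z
        - H s z * H x y := by
    simp [spinInner_apply, cliffordMul_apply, ho, h.crossFour_eq, h.symm x s]
    ring
  have q : ∀ x y : V, spinInner H (cliffordMul H m x (cliffordMul H m y o)) o = -H x y := by
    intro x y
    simp [spinInner_apply, cliffordMul_apply, ho]
  have q' : ∀ x y : V, spinInner H (cliffordMul H m x (cliffordMul H m y o)) (cliffordMul H m s o)
      = H (m s x) y := by
    intro x y
    simp [spinInner_apply, cliffordMul_apply, ho]
    rw [h.symm, h.adj]
  rw [spinForm, hN]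
  have key : spinInner H (cliffordMul H m x (cliffordMul H m y (cliffordMul H m z (a, s)))) (a, s)
      = -(a ^ 2 + H s s) * H (m x y) z
      + 2 * (H s s * H (m x y) z - H s x * H (m s y) z + H s y * H (m s x) z
          - H s z * H (m s x) y) + 2 * a * crossFour H m s x y z := by
    rw [h1]
    have mv := fun x y z => h.cliffordMul_move x y z s o
    simp only [map_add, map_smul, LinearMap.add_apply, LinearMap.smul_apply, mv,
      map_sub, map_neg, LinearMap.neg_apply, LinearMap.sub_apply,
      h.spinInner_cliffordMul_cliffordMul, smul_eq_mul, t, t', q, q']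
    rw [h.spinInner_cliffordMul s, t']
    ring
  rw [key]
  field_simp
  ring

theorem spinForm_one (h : IsCross H m) (x y z : V) :
    spinForm H m (1, 0) x y z = H (m x y) z := by
  rw [h.spinForm_eq 1 0 (by simp)]
  simp [crossFour]

/-- An isometry carries the three-form of a spinor to that of another one, up to the sign of its
determinant. -/
theorem exists_spinForm_isometry [FiniteDimensional ℝ V] (h : IsCross H m) {n : ℕ}
    (b : Module.Basis (Fin n) ℝ V) (hb : ∀ i j, i ≠ j → H (b i) (b j) = 0)
    (hb' : ∀ i, H (b i) (b i) ≠ 0) (f : V ≃ₗ[ℝ] V) (hf : ∀ x y, H (f x) (f y) = H x y) :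
    ∃ s : ℝ, (s = 1 ∨ s = -1) ∧ LinearMap.det (f : V →ₗ[ℝ] V) = s ∧
      ∀ u : ℝ × V, spinInner H u u ≠ 0 → ∃ u' : ℝ × V, spinInner H u' u' ≠ 0 ∧
        ∀ x y z, spinForm H m u (f x) (f y) (f z) = s * spinForm H m u' x y z := by
  refine isometry_induction h.symm b hb hb' (fun f => ∃ s : ℝ, (s = 1 ∨ s = -1) ∧
    LinearMap.det (f : V →ₗ[ℝ] V) = s ∧
      ∀ u : ℝ × V, spinInner H u u ≠ 0 → ∃ u' : ℝ × V, spinInner H u' u' ≠ 0 ∧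
        ∀ x y z, spinForm H m u (f x) (f y) (f z) = s * spinForm H m u' x y z) ?_ ?_ f hf
  · exact ⟨1, Or.inl rfl, by simp, fun u hu => ⟨u, hu, by simp⟩⟩
  · rintro v hv f ⟨s, hs, hdet, H1⟩
    refine ⟨-s, by rcases hs with rfl | rfl <;> simp, ?_, fun u hu => ?_⟩
    · rw [LinearEquiv.coe_trans, LinearMap.det_comp, det_hyperplaneReflection, hdet]
      ring
    · obtain ⟨u', hu', H2⟩ := H1 (cliffordMul H m v u) (by
        rw [h.spinInner_cliffordMul_cliffordMul]; exact mul_ne_zero hv hu)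
      refine ⟨u', hu', fun x y z => ?_⟩
      rw [LinearEquiv.trans_apply, LinearEquiv.trans_apply, LinearEquiv.trans_apply,
        h.spinForm_hyperplaneReflection, H2]
      ring

/-- A non-null spinor `(a, s)` is obtained from `(1, 0)` by Clifford multiplication with two
non-null vectors. -/
theorem exists_cliffordMul_cliffordMul (h : IsCross H m) (a : ℝ) (s v : V) (hv : H v v ≠ 0)
    (hsv : H v s = 0) (hu : a ^ 2 + H s s ≠ 0) :
    ∃ w : V, H w w ≠ 0 ∧ cliffordMul H m v (cliffordMul H m w (1, 0)) = (a, s) := by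
  -- Since v ⟂ s, the spinor v·(a, s) has no scalar part and so is a vector applied to (1, 0).
  -- Dividing by v·v = -H(v, v) gives w.
  have hw : cliffordMul H m (-(1 / H v v) • (a • v + m v s)) (1, 0) =
      -(1 / H v v) • cliffordMul H m v (a, s) := by
    ext <;> simp [cliffordMul_apply, hsv, add_comm]
  refine ⟨-(1 / H v v) • (a • v + m v s), ?_, ?_⟩
  · have e := congrArg (fun p => spinInner H p p) hw
    simp only [map_smul, LinearMap.smul_apply, h.spinInner_cliffordMul_cliffordMul] at e
    intro h0
    simp only [map_smul, LinearMap.smul_apply, smul_eq_mul] at h0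
    rw [smul_eq_mul, smul_eq_mul, ← mul_assoc, ← mul_assoc, mul_assoc _ _ (H _ _), h0] at e
    simp [spinInner_apply, hv] at e
    apply hu
    linear_combination -e
  · rw [hw, map_smul, h.cliffordMul_self, smul_smul]
    simp [hv]

end IsCross

end Spinors

/-! ### The cross product of the imaginary split octonions -/

theorem octIm_re (x : octIm) : (x : ℍ[ℝ] × ℍ[ℝ]).1.re = 0 := by
  have h : octInner (1, 0) x = 0 := x.2
  simpa [octInner] using h

theorem octCross_self (x : octIm) : octCross x x = 0 := by
  have hx := octIm_re x
  obtain ⟨⟨a, b⟩, h⟩ := x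
  simp only at hx
  apply Subtype.ext
  refine Prod.ext ?_ ?_ <;> ext <;> simp [octCross, octMul, octInner, hx] <;> ring

theorem octInner_octCross (x y z : octIm) :
    octInner (octCross x y) z = octInner x (octCross y z) := by
  have hx := octIm_re x
  have hy := octIm_re y
  have hz := octIm_re z
  obtain ⟨⟨a, b⟩, hx'⟩ := x
  obtain ⟨⟨c, d⟩, hy'⟩ := y
  obtain ⟨⟨e, f⟩, hz'⟩ := z
  simp only at hx hy hz
  simp [octCross, octMul, octInner, hx, hy, hz]
  ring

set_option maxHeartbeats 1000000 in
theorem octCross_octCross (x y : octIm) :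
    octCross x (octCross x y) =
      -(octInner (x : ℍ[ℝ] × ℍ[ℝ]) x) • y + octInner (x : ℍ[ℝ] × ℍ[ℝ]) y • x := by
  have hx := octIm_re x
  have hy := octIm_re y
  obtain ⟨⟨a, b⟩, hx'⟩ := x
  obtain ⟨⟨c, d⟩, hy'⟩ := y
  simp only at hx hy
  apply Subtype.ext
  refine Prod.ext ?_ ?_ <;> ext <;> simp [octCross, octMul, octInner, hx, hy] <;> ring

/-- The coordinates of imaginary split octonions. -/
noncomputable def octCoord : octIm ≃ₗ[ℝ] (Fin 7 → ℝ) where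
  toFun x := ![(x : ℍ[ℝ] × ℍ[ℝ]).1.imI, (x : ℍ[ℝ] × ℍ[ℝ]).1.imJ, (x : ℍ[ℝ] × ℍ[ℝ]).1.imK,
    (x : ℍ[ℝ] × ℍ[ℝ]).2.re, (x : ℍ[ℝ] × ℍ[ℝ]).2.imI, (x : ℍ[ℝ] × ℍ[ℝ]).2.imJ,
    (x : ℍ[ℝ] × ℍ[ℝ]).2.imK]
  map_add' x y := by simp
  map_smul' c x := by simp
  invFun w := ⟨(⟨0, w 0, w 1, w 2⟩, ⟨w 3, w 4, w 5, w 6⟩), by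
    change octInner (1, 0) _ = 0
    simp only [octInner, one_mul, zero_mul, Quaternion.re_zero, sub_zero]
    exact Quaternion.re_star _⟩
  left_inv x := by
    apply Subtype.ext
    refine Prod.ext ?_ ?_ <;> ext <;> simp [octIm_re]
  right_inv w := by
    ext i
    fin_cases i <;> rfl

theorem octCoord_symm_components (w : Fin 7 → ℝ) :
    (octCoord.symm w : ℍ[ℝ] × ℍ[ℝ]).1.re = 0 ∧ (octCoord.symm w : ℍ[ℝ] × ℍ[ℝ]).1.imI = w 0 ∧
    (octCoord.symm w : ℍ[ℝ] × ℍ[ℝ]).1.imJ = w 1 ∧ (octCoord.symm w : ℍ[ℝ] × ℍ[ℝ]).1.imK = w 2 ∧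
    (octCoord.symm w : ℍ[ℝ] × ℍ[ℝ]).2.re = w 3 ∧ (octCoord.symm w : ℍ[ℝ] × ℍ[ℝ]).2.imI = w 4 ∧
    (octCoord.symm w : ℍ[ℝ] × ℍ[ℝ]).2.imJ = w 5 ∧ (octCoord.symm w : ℍ[ℝ] × ℍ[ℝ]).2.imK = w 6 :=
  ⟨rfl, rfl, rfl, rfl, rfl, rfl, rfl, rfl⟩

/-! ### Coordinate forms over any commutative ring, so that structure constants can be computed over
ℤ. -/

section Coordinates

variable {R : Type*} [CommRing R]

/-- The quadratic form of the imaginary split octonions in coordinates, polarised. -/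
def octGram (x y : Fin 7 → R) : R :=
  x 0 * y 0 + x 1 * y 1 + x 2 * y 2 - x 3 * y 3 - x 4 * y 4 - x 5 * y 5 - x 6 * y 6

/-- The alternating form `det(x_{ijk}, y_{ijk}, z_{ijk})`. -/
def minorThree (i j k : Fin 7) (x y z : Fin 7 → R) : R :=
  x i * (y j * z k - y k * z j) - x j * (y i * z k - y k * z i) + x k * (y i * z j - y j * z i)

/-- The three-form of the imaginary split octonions in coordinates. -/
def octTriple (x y z : Fin 7 → R) : R :=
  minorThree 0 1 2 x y z - minorThree 0 3 4 x y z + minorThree 0 5 6 x y z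
    - minorThree 1 3 5 x y z - minorThree 1 4 6 x y z - minorThree 2 3 6 x y z
    + minorThree 2 4 5 x y z

end Coordinates

theorem octInner_octCoord_symm (x y : Fin 7 → ℝ) :
    octInner (octCoord.symm x : ℍ[ℝ] × ℍ[ℝ]) (octCoord.symm y) = octGram x y := by
  simp [octCoord_symm_components, octInner, octGram]
  ring

theorem octInner_octCross_octCoord_symm (x y z : Fin 7 → ℝ) :
    octInner (octCross (octCoord.symm x) (octCoord.symm y)) (octCoord.symm z) =
      octTriple x y z := by
  simp [octCoord_symm_components, octInner, octTriple, minorThree, octCross, octMul]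
  ring

/-- The Gram matrix of the standard basis of the imaginary split octonions. -/
def gramCoeff (i j : Fin 7) : ℤ := if i = j then (if i < 3 then 1 else -1) else 0

/-- The structure constants of the standard basis of the imaginary split octonions. -/
def tripleCoeff (i j k : Fin 7) : ℤ :=
  octTriple (Pi.single i 1) (Pi.single j 1) (Pi.single k 1)

theorem octGram_single (i j : Fin 7) :
    octGram (Pi.single i (1 : ℝ)) (Pi.single j 1) = gramCoeff i j := by
  have h : ∀ i j : Fin 7, octGram (Pi.single i (1 : ℤ)) (Pi.single j 1) = gramCoeff i j := by
    decide
  rw [← h]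
  simp [octGram, Pi.single_apply]

theorem octTriple_single (i j k : Fin 7) :
    octTriple (Pi.single i (1 : ℝ)) (Pi.single j 1) (Pi.single k 1) = tripleCoeff i j k := by
  simp [tripleCoeff, octTriple, minorThree, Pi.single_apply]

section

variable {V : Type*} [AddCommGroup V] [Module ℝ V] {W : Type*} [AddCommGroup W] [Module ℝ W]

/-! ### Naturality of the induced metric and volume form -/

theorem crossMetric_conj {m : V →ₗ[ℝ] V →ₗ[ℝ] V} {m' : W →ₗ[ℝ] W →ₗ[ℝ] W} (f : V ≃ₗ[ℝ] W)
    (hf : ∀ x y, f (m x y) = m' (f x) (f y)) (x y : V) :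
    crossMetric m' (f x) (f y) = crossMetric m x y := by
  have : m' (f x) ∘ₗ m' (f y) = f.conj (m x ∘ₗ m y) := by
    ext z
    simp [LinearEquiv.conj_apply, hf]
  simp only [crossMetric, LinearMap.mk₂_apply, this, LinearMap.trace_conj']

theorem crossVol_conj {m : V →ₗ[ℝ] V →ₗ[ℝ] V} {m' : W →ₗ[ℝ] W →ₗ[ℝ] W} (f : V ≃ₗ[ℝ] W)
    (hf : ∀ x y, f (m x y) = m' (f x) (f y)) (v : Fin 7 → V) :
    crossVol m' (fun i => f (v i)) = crossVol m v := by
  simp only [crossVol, AlternatingMap.smul_apply, MultilinearMap.alternatization_apply]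
  congr 1
  refine Finset.sum_congr rfl fun σ _ => ?_
  congr 1
  simp [crossTensor, ← hf, crossMetric_conj f hf]

/-! ### Split cross products -/

/-- In dimension 7 the trace of the polarized contraction identity is -14 H + 2 H, so tr(m x ∘ m y)
= -6 H(x, y). -/
theorem IsCross.crossMetric_eq {H : LinearMap.BilinForm ℝ V} {m : V →ₗ[ℝ] V →ₗ[ℝ] V}
    [FiniteDimensional ℝ V] (hV : Module.finrank ℝ V = 7) (h : IsCross H m) :
    crossMetric m = H := by
  ext x y
  have e : m x ∘ₗ m y + m y ∘ₗ m x =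
      -(2 * H x y) • LinearMap.id + (H x).smulRight y + (H y).smulRight x := by
    ext z
    simp [h.contr_polar]
  have := congrArg (LinearMap.trace ℝ V) e
  rw [map_add, map_add, map_add, map_smul, LinearMap.trace_id, hV, LinearMap.trace_smulRight,
    LinearMap.trace_smulRight, LinearMap.trace_comp_comm', h.symm y x, smul_eq_mul] at this
  simp only [crossMetric, LinearMap.mk₂_apply]
  rw [LinearMap.trace_comp_comm']
  push_cast at this
  linarith

/-- The form `octInner` transported along a linear isomorphism. -/
noncomputable def octTransport (A : octIm ≃ₗ[ℝ] V) : LinearMap.BilinForm ℝ V :=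
  LinearMap.mk₂ ℝ (fun x y => octInner (A.symm x : ℍ[ℝ] × ℍ[ℝ]) (A.symm y))
    (by intro x x' y; simp [octInner]; ring)
    (by intro c x y; simp [octInner]; ring)
    (by intro x x' y; simp [octInner]; ring)
    (by intro c x y; simp [octInner]; ring)

theorem octTransport_apply (A : octIm ≃ₗ[ℝ] V) (x y : octIm) :
    octTransport A (A x) (A y) = octInner (x : ℍ[ℝ] × ℍ[ℝ]) y := by
  simp [octTransport]

theorem octTransport_isCross {m : V →ₗ[ℝ] V →ₗ[ℝ] V} (A : octIm ≃ₗ[ℝ] V)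
    (hA : ∀ x y : octIm, A (octCross x y) = m (A x) (A y)) : IsCross (octTransport A) m where
  symm x y := by simp [octTransport, octInner]; ring
  self x := by
    obtain ⟨x, rfl⟩ := A.surjective x
    rw [← hA, octCross_self, map_zero]
  adj x y z := by
    obtain ⟨x, rfl⟩ := A.surjective x
    obtain ⟨y, rfl⟩ := A.surjective y
    obtain ⟨z, rfl⟩ := A.surjective z
    rw [← hA, ← hA, octTransport_apply, octTransport_apply, octInner_octCross]
  contr x y := by
    obtain ⟨x, rfl⟩ := A.surjective x
    obtain ⟨y, rfl⟩ := A.surjective y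
    rw [← hA, ← hA, octTransport_apply, octTransport_apply, octCross_octCross, map_add, map_smul,
      map_smul]

theorem IsSplitCrossProduct.isCross {m : V →ₗ[ℝ] V →ₗ[ℝ] V} [FiniteDimensional ℝ V]
    (hV : Module.finrank ℝ V = 7) (hm : IsSplitCrossProduct m) : IsCross (crossMetric m) m := by
  obtain ⟨A, hA⟩ := hm
  have h := octTransport_isCross A hA
  rwa [h.crossMetric_eq hV]

/-- A basis of `V` that corresponds to the standard basis of the imaginary split octonions. -/
structure IsAdapted (m : V →ₗ[ℝ] V →ₗ[ℝ] V) (b : Module.Basis (Fin 7) ℝ V) : Prop where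
  gram : ∀ i j, crossMetric m (b i) (b j) = gramCoeff i j
  triple : ∀ i j k, crossMetric m (m (b i) (b j)) (b k) = tripleCoeff i j k

theorem IsSplitCrossProduct.exists_isAdapted {m : V →ₗ[ℝ] V →ₗ[ℝ] V} [FiniteDimensional ℝ V]
    (hV : Module.finrank ℝ V = 7) (hm : IsSplitCrossProduct m) : ∃ b, IsAdapted m b := by
  obtain ⟨A, hA⟩ := hm
  have h := octTransport_isCross A hA
  let b : Module.Basis (Fin 7) ℝ V := .ofEquivFun (A.symm.trans octCoord)
  have hb : ∀ i, b i = A (octCoord.symm (Pi.single i 1)) := fun i => by simp [b]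
  refine ⟨b, fun i j => ?_, fun i j k => ?_⟩
  · rw [h.crossMetric_eq hV, hb, hb, octTransport_apply, octInner_octCoord_symm, octGram_single]
  · rw [h.crossMetric_eq hV, hb, hb, hb, ← hA, octTransport_apply, octInner_octCross_octCoord_symm,
      octTriple_single]

end

/-! ### Integer identities for the structure constants -/

/-- The Levi-Civita symbol. -/
def leviCivita {n : ℕ} (I : Fin n → Fin n) : ℤ :=
  ∏ j, ∏ i ∈ Finset.Iio j, if I i < I j then 1 else if I i = I j then 0 else -1

/-- The components of the four-form `crossFour` in the standard basis. -/
def fourCoeff (i j k l : Fin 7) : ℤ :=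
  (∑ a, gramCoeff a a * tripleCoeff i j a * tripleCoeff k l a) -
    gramCoeff i k * gramCoeff j l + gramCoeff i l * gramCoeff j k

/-- The sum of the values of `g` over the positively minus the negatively oriented orderings. -/
def altSum {R : Type*} [CommRing R] (g : Fin 7 → Fin 7 → Fin 7 → R) (i j k : Fin 7) : R :=
  g i j k - g i k j - (g j i k - g j k i) + (g k i j - g k j i)

theorem sum_minorThree {R : Type*} [CommRing R] (g : Fin 7 → Fin 7 → Fin 7 → R) (a b c : Fin 7) :
    ∑ i, ∑ j, ∑ k, minorThree a b c (Pi.single i 1) (Pi.single j 1) (Pi.single k 1) * g i j k =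
      altSum g a b c := by
  simp [minorThree, altSum, add_mul, sub_mul, mul_sub, Finset.sum_add_distrib,
    Finset.sum_sub_distrib, Pi.single_apply, ite_mul]

/-- Only 7 · 6 of the 343 terms survive, which keeps the finite check in
`sum_tripleCoeff_leviCivita` small. -/
theorem sum_octTriple {R : Type*} [CommRing R] (g : Fin 7 → Fin 7 → Fin 7 → R) :
    ∑ i, ∑ j, ∑ k, octTriple (Pi.single i 1) (Pi.single j 1) (Pi.single k 1) * g i j k =
      altSum g 0 1 2 - altSum g 0 3 4 + altSum g 0 5 6 - altSum g 1 3 5 - altSum g 1 4 6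
        - altSum g 2 3 6 + altSum g 2 4 5 := by
  simp only [octTriple, add_mul, sub_mul, Finset.sum_add_distrib, Finset.sum_sub_distrib,
    sum_minorThree]

set_option maxRecDepth 100000 in
theorem sum_tripleCoeff_leviCivita : ∀ a b c d : Fin 7, a < b → b < c → c < d →
    ∑ i, ∑ j, ∑ k, tripleCoeff i j k * leviCivita ![i, j, k, a, b, c, d] =
      -6 * fourCoeff a b c d := by
  simp only [tripleCoeff, sum_octTriple]
  decide +kernel

/-- Each nonzero structure constant involves an even number of negative directions, so raising all
three indices changes nothing. -/
theorem gramCoeff_mul_tripleCoeff : ∀ i j k : Fin 7,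
    gramCoeff i i * gramCoeff j j * gramCoeff k k * tripleCoeff i j k = tripleCoeff i j k := by
  decide +kernel

/-- For distinct indices the inner sum equals `fourCoeff`, which is alternating, so this is a sum of
squares: ±1 on each of the 4! orderings of seven quadruples. -/
theorem sum_fourCoeff : ∑ i, ∑ j, ∑ k, ∑ l,
    (∑ a, gramCoeff a a * tripleCoeff i j a * tripleCoeff k l a) * fourCoeff i j k l = 168 := by
  decide +kernel

/-! ### Determinants and permutation sums -/

theorem leviCivita_perm {n : ℕ} (σ : Equiv.Perm (Fin n)) :
    leviCivita σ = (Equiv.Perm.sign σ : ℤ) := by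
  rw [Equiv.Perm.sign_eq_prod_prod_Iio, leviCivita]
  push_cast
  refine Finset.prod_congr rfl fun j _ => Finset.prod_congr rfl fun i hi => ?_
  have hne : σ i ≠ σ j := fun e => (Finset.mem_Iio.1 hi).ne (σ.injective e)
  by_cases h : σ i < σ j <;> simp [h, hne]

theorem leviCivita_eq_zero {n : ℕ} {I : Fin n → Fin n} (hI : ¬ Function.Injective I) :
    leviCivita I = 0 := by
  obtain ⟨i, j, hij, hne⟩ := Function.not_injective_iff.1 hI
  wlog hlt : i < j generalizing i j
  · exact this j i hij.symm hne.symm (lt_of_le_of_ne (not_lt.1 hlt) hne.symm)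
  refine Finset.prod_eq_zero (Finset.mem_univ j) (Finset.prod_eq_zero (Finset.mem_Iio.2 hlt) ?_)
  simp [hij]

section

variable {V : Type*} [AddCommGroup V] [Module ℝ V]

theorem basis_det_comp {n : ℕ} (b : Module.Basis (Fin n) ℝ V) (I : Fin n → Fin n) :
    b.det (fun i => b (I i)) = leviCivita I := by
  by_cases hI : Function.Injective I
  · let σ : Equiv.Perm (Fin n) := Equiv.ofBijective I (Finite.injective_iff_bijective.1 hI)
    have h1 : b.det (fun i => b (I i)) = b.det (b ∘ σ) := rfl
    rw [h1, AlternatingMap.map_perm, b.det_self, show I = σ from rfl, leviCivita_perm,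
      Units.smul_def]
    simp
  · obtain ⟨i, j, hij, hne⟩ := Function.not_injective_iff.1 hI
    rw [leviCivita_eq_zero hI, AlternatingMap.map_eq_zero_of_eq _ _ (by rw [hij]) hne]
    simp

/-- Passing from permutations to all index maps makes the seven indices independent, so that three
of them can be summed separately. -/
theorem alternatization_basis {n : ℕ} (T : MultilinearMap ℝ (fun _ : Fin n => V) ℝ)
    (b : Module.Basis (Fin n) ℝ V) :
    MultilinearMap.alternatization T b =
      ∑ I : Fin n → Fin n, leviCivita I * T (fun i => b (I i)) := by
  rw [MultilinearMap.alternatization_apply]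
  refine Fintype.sum_of_injective (fun σ : Equiv.Perm (Fin n) => (σ : Fin n → Fin n))
    DFunLike.coe_injective _ _ ?_ ?_
  · intro I hI
    rw [leviCivita_eq_zero, Int.cast_zero, zero_mul]
    exact fun h => hI ⟨Equiv.ofBijective I (Finite.injective_iff_bijective.1 h), rfl⟩
  · intro σ
    rw [leviCivita_perm, MultilinearMap.domDomCongr_apply, Units.smul_def]
    simp

theorem sum_fin_succ_fun {α M : Type*} [Fintype α] [AddCommMonoid M] {n : ℕ}
    (g : (Fin (n + 1) → α) → M) : ∑ I, g I = ∑ a, ∑ J, g (Matrix.vecCons a J) := by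
  rw [← (Fin.consEquiv fun _ => α).sum_comp, Fintype.sum_prod_type]
  rfl

theorem alternating_rotate (ω : V [⋀^Fin 7]→ₗ[ℝ] ℝ) (a b c d e f g : V) :
    ω ![a, b, c, d, e, f, g] = ω ![b, c, d, e, f, g, a] := by
  have h := ω.map_perm ![a, b, c, d, e, f, g] (finRotate 7)
  rw [sign_finRotate] at h
  norm_num at h
  rw [← h]
  congr 1
  funext i
  fin_cases i <;> rfl

theorem alternating_rotate_four (ω : V [⋀^Fin 7]→ₗ[ℝ] ℝ) (a b c d e f g : V) :
    ω ![a, b, c, d, e, f, g] = ω ![e, f, g, a, b, c, d] := by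
  rw [alternating_rotate, alternating_rotate, alternating_rotate, alternating_rotate]

/-- Alternating maps that agree on increasing tuples of basis vectors are equal. -/
theorem alternating_ext_strictMono {n k : ℕ} (b : Module.Basis (Fin n) ℝ V)
    {f g : V [⋀^Fin k]→ₗ[ℝ] ℝ}
    (h : ∀ I : Fin k → Fin n, StrictMono I → f (fun i => b (I i)) = g (fun i => b (I i))) :
    f = g := by
  refine b.ext_alternating fun v hv => ?_
  let σ := Tuple.sort v
  have hσ : StrictMono (v ∘ σ) :=
    (Tuple.monotone_sort v).strictMono_of_injective (hv.comp σ.injective)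
  have e := h _ hσ
  have ef := f.map_perm (fun i => b (v i)) σ
  have eg := g.map_perm (fun i => b (v i)) σ
  have : Equiv.Perm.sign σ • f (fun i => b (v i)) = Equiv.Perm.sign σ • g (fun i => b (v i)) := by
    rw [← ef, ← eg]; exact e
  exact smul_left_cancel _ this

/-! ### The four-form of a cross product -/

namespace IsCross

variable {H : LinearMap.BilinForm ℝ V} {m : V →ₗ[ℝ] V →ₗ[ℝ] V}

theorem crossFour_antisymm (h : IsCross H m) (s x y z : V) :
    crossFour H m s x y z = -crossFour H m x s y z := by
  rw [crossFour, crossFour, h.antisymm s x]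
  simp only [map_neg, LinearMap.neg_apply]
  ring

theorem crossFour_antisymm' (h : IsCross H m) (s x y z : V) :
    crossFour H m s x y z = -crossFour H m s x z y := by
  rw [crossFour, crossFour, h.antisymm y z]
  simp only [map_neg]
  ring

theorem crossFour_self_left (h : IsCross H m) (s y z : V) : crossFour H m s s y z = 0 := by
  rw [crossFour, h.self]; simp; ring

theorem crossFour_self_right (h : IsCross H m) (s x z : V) : crossFour H m s x z z = 0 := by
  rw [crossFour, h.self]; simp

/-- This is where the metric terms of `crossFour` are needed: they cancel the right-hand side of
`contr`. -/
theorem crossFour_self_middle (h : IsCross H m) (s x z : V) : crossFour H m s x x z = 0 := by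
  rw [h.crossFour_eq, h.contr, h.symm s x, h.symm s z]
  simp only [map_add, map_smul, LinearMap.add_apply, LinearMap.smul_apply, smul_eq_mul,
    h.symm z s]
  ring

/-- `crossFour` as an alternating map. -/
def crossFourForm (h : IsCross H m) : V [⋀^Fin 4]→ₗ[ℝ] ℝ where
  toFun v := crossFour H m (v 0) (v 1) (v 2) (v 3)
  map_update_add' := by
    intro inst v i x y
    fin_cases i <;> simp [crossFour, Fin.ext_iff] <;> ring
  map_update_smul' := by
    intro inst v i c x
    fin_cases i <;> simp [crossFour, Fin.ext_iff] <;> ring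
  map_eq_zero_of_eq' := by
    have h02 : ∀ s x z, crossFour H m s x s z = 0 := fun s x z => by
      rw [h.crossFour_antisymm, h.crossFour_self_middle, neg_zero]
    have h13 : ∀ s x y, crossFour H m s x y x = 0 := fun s x y => by
      rw [h.crossFour_antisymm', h.crossFour_self_middle, neg_zero]
    have h03 : ∀ s x y, crossFour H m s x y s = 0 := fun s x y => by
      rw [h.crossFour_antisymm', h02, neg_zero]
    intro v i j hij hne
    fin_cases i <;> fin_cases j <;> simp at hne <;> simp at hij <;>
      simp [hij, h02, h13, h03, h.crossFour_self_left, h.crossFour_self_right,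
        h.crossFour_self_middle]

theorem crossFourForm_apply (h : IsCross H m) (v : Fin 4 → V) :
    h.crossFourForm v = crossFour H m (v 0) (v 1) (v 2) (v 3) := rfl

end IsCross

/-! ### Dual families -/

theorem eq_sum_dual_family {ι : Type*} [Fintype ι] [DecidableEq ι]
    {H : LinearMap.BilinForm ℝ V} (b : Module.Basis ι ℝ V) (c : ι → V)
    (hc : ∀ i j, H (c i) (b j) = if i = j then 1 else 0) (v : V) : v = ∑ i, H (c i) v • b i := by
  conv_lhs => rw [← b.sum_repr v]
  refine Finset.sum_congr rfl fun i _ => ?_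
  rw [← congrArg (H (c i)) (b.sum_repr v)]
  simp [hc, -Module.Basis.sum_repr]

/-- The tensor ∑ cᵢ ⊗ bᵢ is the inverse metric, hence basis-independent. This moves the Hodge star
from the arbitrary `Module.finBasis` to an adapted basis. -/
theorem sum_dual_family {ι κ : Type*} [Fintype ι] [Fintype κ] [DecidableEq ι] [DecidableEq κ]
    {H : LinearMap.BilinForm ℝ V} (hH : ∀ w, (∀ v, H w v = 0) → w = 0)
    (b : Module.Basis ι ℝ V) (c : ι → V) (hc : ∀ i j, H (c i) (b j) = if i = j then 1 else 0)
    (b' : Module.Basis κ ℝ V) (c' : κ → V)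
    (hc' : ∀ i j, H (c' i) (b' j) = if i = j then 1 else 0) (φ ψ : V →ₗ[ℝ] ℝ) :
    ∑ i, φ (c i) * ψ (b i) = ∑ k, φ (c' k) * ψ (b' k) := by
  have h1 := fun k => eq_sum_dual_family b c hc (b' k)
  have h2 : ∀ i, c i = ∑ k, H (c i) (b' k) • c' k := by
    intro i
    rw [← sub_eq_zero]
    apply hH
    intro v
    rw [← b'.sum_repr v, map_sum]
    refine Finset.sum_eq_zero fun k _ => ?_
    simp [hc']
  calc ∑ i, φ (c i) * ψ (b i) = ∑ i, ∑ k, H (c i) (b' k) * φ (c' k) * ψ (b i) := by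
        refine Finset.sum_congr rfl fun i _ => ?_
        rw [← Finset.sum_mul]
        congr 1
        conv_lhs => rw [h2 i]
        simp
    _ = ∑ k, φ (c' k) * ψ (b' k) := by
        rw [Finset.sum_comm]
        refine Finset.sum_congr rfl fun k _ => ?_
        conv_rhs => rw [h1 k]
        simp only [map_sum, map_smul, smul_eq_mul, Finset.mul_sum]
        exact Finset.sum_congr rfl fun i _ => by ring

/-- Insertion of a vector in the slot `i` of a tuple, for an alternating map. -/
theorem exists_linear_slot {n : ℕ} (ω : V [⋀^Fin n]→ₗ[ℝ] ℝ) (v : Fin n → V) (i : Fin n) :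
    ∃ φ : V →ₗ[ℝ] ℝ, ∀ x, φ x = ω (Function.update v i x) :=
  ⟨ω.toMultilinearMap.toLinearMap v i, fun _ => rfl⟩

theorem sum_dual_family_three {ι κ : Type*} [Fintype ι] [Fintype κ] [DecidableEq ι]
    [DecidableEq κ] {H : LinearMap.BilinForm ℝ V} (hH : ∀ w, (∀ v, H w v = 0) → w = 0)
    (b : Module.Basis ι ℝ V) (c : ι → V) (hc : ∀ i j, H (c i) (b j) = if i = j then 1 else 0)
    (b' : Module.Basis κ ℝ V) (c' : κ → V)
    (hc' : ∀ i j, H (c' i) (b' j) = if i = j then 1 else 0) (β : V [⋀^Fin 3]→ₗ[ℝ] ℝ)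
    (ω : V [⋀^Fin 7]→ₗ[ℝ] ℝ) (x y z w : V) :
    ∑ i, ∑ j, ∑ k, β ![c i, c j, c k] * ω ![b i, b j, b k, x, y, z, w] =
      ∑ i, ∑ j, ∑ k, β ![c' i, c' j, c' k] * ω ![b' i, b' j, b' k, x, y, z, w] := by
  have e := fun φ ψ => sum_dual_family hH b c hc b' c' hc' φ ψ
  have e3 : ∀ p q p' q' : V, ∑ k, β ![p, q, c k] * ω ![p', q', b k, x, y, z, w] =
      ∑ k, β ![p, q, c' k] * ω ![p', q', b' k, x, y, z, w] := by
    intro p q p' q'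
    obtain ⟨φ, hφ⟩ := exists_linear_slot β ![p, q, 0] 2
    obtain ⟨ψ, hψ⟩ := exists_linear_slot ω ![p', q', 0, x, y, z, w] 2
    have h1 : ∀ t, φ t = β ![p, q, t] := fun t => by
      rw [hφ]; congr 1; funext i; fin_cases i <;> rfl
    have h2 : ∀ t, ψ t = ω ![p', q', t, x, y, z, w] := fun t => by
      rw [hψ]; congr 1; funext i; fin_cases i <;> rfl
    simpa only [h1, h2] using e φ ψ
  have e2 : ∀ p q p' q' : V, ∑ k, β ![p, c k, q] * ω ![p', b k, q', x, y, z, w] =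
      ∑ k, β ![p, c' k, q] * ω ![p', b' k, q', x, y, z, w] := by
    intro p q p' q'
    obtain ⟨φ, hφ⟩ := exists_linear_slot β ![p, 0, q] 1
    obtain ⟨ψ, hψ⟩ := exists_linear_slot ω ![p', 0, q', x, y, z, w] 1
    have h1 : ∀ t, φ t = β ![p, t, q] := fun t => by
      rw [hφ]; congr 1; funext i; fin_cases i <;> rfl
    have h2 : ∀ t, ψ t = ω ![p', t, q', x, y, z, w] := fun t => by
      rw [hψ]; congr 1; funext i; fin_cases i <;> rfl
    simpa only [h1, h2] using e φ ψ
  have e1 : ∀ p q p' q' : V, ∑ k, β ![c k, p, q] * ω ![b k, p', q', x, y, z, w] =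
      ∑ k, β ![c' k, p, q] * ω ![b' k, p', q', x, y, z, w] := by
    intro p q p' q'
    obtain ⟨φ, hφ⟩ := exists_linear_slot β ![0, p, q] 0
    obtain ⟨ψ, hψ⟩ := exists_linear_slot ω ![0, p', q', x, y, z, w] 0
    have h1 : ∀ t, φ t = β ![t, p, q] := fun t => by
      rw [hφ]; congr 1; funext i; fin_cases i <;> rfl
    have h2 : ∀ t, ψ t = ω ![t, p', q', x, y, z, w] := fun t => by
      rw [hψ]; congr 1; funext i; fin_cases i <;> rfl
    simpa only [h1, h2] using e φ ψ
  calc ∑ i, ∑ j, ∑ k, β ![c i, c j, c k] * ω ![b i, b j, b k, x, y, z, w]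
      = ∑ i, ∑ j, ∑ k, β ![c i, c j, c' k] * ω ![b i, b j, b' k, x, y, z, w] :=
        Finset.sum_congr rfl fun i _ => Finset.sum_congr rfl fun j _ => e3 _ _ _ _
    _ = ∑ i, ∑ k, ∑ j, β ![c i, c' j, c' k] * ω ![b i, b' j, b' k, x, y, z, w] := by
        refine Finset.sum_congr rfl fun i _ => ?_
        rw [Finset.sum_comm]
        exact Finset.sum_congr rfl fun k _ => e2 _ _ _ _
    _ = ∑ k, ∑ j, ∑ i, β ![c' i, c' j, c' k] * ω ![b' i, b' j, b' k, x, y, z, w] := by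
        rw [Finset.sum_comm]
        refine Finset.sum_congr rfl fun k _ => ?_
        rw [Finset.sum_comm]
        exact Finset.sum_congr rfl fun j _ => e1 _ _ _ _
    _ = _ := by
        rw [Finset.sum_comm]
        conv_rhs => rw [Finset.sum_comm]
        refine Finset.sum_congr rfl fun k _ => ?_
        rw [Finset.sum_comm]

theorem raisedBasis_dual {ι : Type*} [Fintype ι] [DecidableEq ι] {H : LinearMap.BilinForm ℝ V}
    (hH : ∀ w, (∀ v, H w v = 0) → w = 0) (b : Module.Basis ι ℝ V) (i j : ι) :
    H (raisedBasis H b i) (b j) = if i = j then 1 else 0 := by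
  have hdet : IsUnit (LinearMap.BilinForm.toMatrix b H).det := by
    rw [isUnit_iff_ne_zero]
    intro h0
    obtain ⟨v, hv, h⟩ := Matrix.exists_vecMul_eq_zero_iff.2 h0
    apply hv
    have hw : ∑ i, v i • b i = 0 := by
      apply hH
      intro w
      rw [← b.sum_repr w, map_sum]
      refine Finset.sum_eq_zero fun k _ => ?_
      have := congrFun h k
      simp only [Matrix.vecMul, dotProduct, LinearMap.BilinForm.toMatrix_apply,
        Pi.zero_apply] at this
      simp [this]
    funext i
    exact Fintype.linearIndependent_iff.1 b.linearIndependent v hw i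
  have h := congrFun (congrFun (Matrix.nonsing_inv_mul _ hdet) i) j
  rw [Matrix.mul_apply, Matrix.one_apply] at h
  simpa [raisedBasis, LinearMap.BilinForm.toMatrix_apply] using h

end

section

variable {V : Type*} [AddCommGroup V] [Module ℝ V]

theorem hook_apply {n : ℕ} (S : V) (ω : V [⋀^Fin (n + 1)]→ₗ[ℝ] ℝ) (v : Fin n → V) :
    hook S ω v = ω (Matrix.vecCons S v) := rfl

theorem alternating_sum_apply {ι : Type*} {n : ℕ} (s : Finset ι) (f : ι → V [⋀^Fin n]→ₗ[ℝ] ℝ)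
    (v : Fin n → V) : (∑ i ∈ s, f i) v = ∑ i ∈ s, f i v := by
  classical
  induction s using Finset.induction_on with
  | empty => simp
  | insert a s ha ih =>
    rw [Finset.sum_insert ha, Finset.sum_insert ha, AlternatingMap.add_apply, ih]

/-! ### Computations in an adapted basis -/

namespace IsAdapted

variable {m : V →ₗ[ℝ] V →ₗ[ℝ] V} {b : Module.Basis (Fin 7) ℝ V}

theorem dual (hb : IsAdapted m b) (i j : Fin 7) :
    crossMetric m ((gramCoeff i i : ℝ) • b i) (b j) = if i = j then 1 else 0 := by
  have h : ∀ i j : Fin 7, gramCoeff i i * gramCoeff i j = if i = j then 1 else 0 := by decide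
  rw [map_smul, LinearMap.smul_apply, hb.gram, smul_eq_mul, ← Int.cast_mul, h]
  split_ifs <;> simp

theorem orthogonal (hb : IsAdapted m b) (i j : Fin 7) (hij : i ≠ j) :
    crossMetric m (b i) (b j) = 0 := by
  rw [hb.gram, gramCoeff, if_neg hij, Int.cast_zero]

theorem nonnull (hb : IsAdapted m b) (i : Fin 7) : crossMetric m (b i) (b i) ≠ 0 := by
  intro h
  have := hb.dual i i
  rw [map_smul, LinearMap.smul_apply, h] at this
  simp at this

theorem metric_eq_sum (hb : IsAdapted m b) (h : IsCross (crossMetric m) m) (x y : V) :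
    crossMetric m x y =
      ∑ a, gramCoeff a a * crossMetric m x (b a) * crossMetric m y (b a) := by
  conv_lhs => rw [eq_sum_dual_family b _ hb.dual y]
  rw [map_sum]
  refine Finset.sum_congr rfl fun a _ => ?_
  rw [map_smul, map_smul, LinearMap.smul_apply, smul_eq_mul, smul_eq_mul, h.symm (b a) y]
  ring

theorem nondegenerate (hb : IsAdapted m b) (h : IsCross (crossMetric m) m) (w : V)
    (hw : ∀ v, crossMetric m w v = 0) : w = 0 := by
  rw [eq_sum_dual_family b _ hb.dual w]
  refine Finset.sum_eq_zero fun a _ => ?_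
  rw [map_smul, LinearMap.smul_apply, h.symm, hw, smul_zero, zero_smul]

theorem metric_cross_cross (hb : IsAdapted m b) (h : IsCross (crossMetric m) m)
    (i j k l : Fin 7) : crossMetric m (m (b i) (b j)) (m (b k) (b l)) =
      ((∑ a, gramCoeff a a * tripleCoeff i j a * tripleCoeff k l a : ℤ) : ℝ) := by
  rw [hb.metric_eq_sum h]
  push_cast
  exact Finset.sum_congr rfl fun a _ => by rw [hb.triple, hb.triple]

theorem crossFour_basis (hb : IsAdapted m b) (h : IsCross (crossMetric m) m)
    (i j k l : Fin 7) :
    crossFour (crossMetric m) m (b i) (b j) (b k) (b l) = fourCoeff i j k l := by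
  rw [crossFour, hb.metric_cross_cross h, fourCoeff, hb.gram, hb.gram, hb.gram, hb.gram]
  push_cast
  ring

/-- The contraction of the three-form with the determinant of an adapted basis. -/
theorem contraction_det (hb : IsAdapted m b) (h : IsCross (crossMetric m) m) (x y z w : V) :
    ∑ i, ∑ j, ∑ k, tripleCoeff i j k * b.det ![b i, b j, b k, x, y, z, w] =
      -6 * crossFour (crossMetric m) m x y z w := by
  let K : V [⋀^Fin 4]→ₗ[ℝ] ℝ := ∑ i, ∑ j, ∑ k,
    (tripleCoeff i j k : ℝ) • hook (b k) (hook (b j) (hook (b i) b.det))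
  have hK : ∀ v, K v = ∑ i, ∑ j, ∑ k, (tripleCoeff i j k : ℝ) * b.det
      (Matrix.vecCons (b i) (Matrix.vecCons (b j) (Matrix.vecCons (b k) v))) := by
    intro v
    simp only [K, alternating_sum_apply, AlternatingMap.smul_apply, hook_apply, smul_eq_mul]
  -- Both sides are 4-forms, so increasing quadruples of basis vectors suffice, and there the claim
  -- is an integer identity.
  have key : K = (-6 : ℝ) • h.crossFourForm := by
    refine alternating_ext_strictMono b fun I hI => ?_
    rw [AlternatingMap.smul_apply, h.crossFourForm_apply, hb.crossFour_basis h, hK, smul_eq_mul]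
    have e := sum_tripleCoeff_leviCivita (I 0) (I 1) (I 2) (I 3) (hI (by decide))
      (hI (by decide)) (hI (by decide))
    have e' := congrArg (Int.cast : ℤ → ℝ) e
    push_cast at e'
    rw [← e']
    refine Finset.sum_congr rfl fun i _ => Finset.sum_congr rfl fun j _ =>
      Finset.sum_congr rfl fun k _ => ?_
    rw [← basis_det_comp b]
    congr 2
    funext a
    fin_cases a <;> rfl
  have := congrArg (fun f => f ![x, y, z, w]) key
  simp only [hK, AlternatingMap.smul_apply, smul_eq_mul] at this
  exact this

/-- Summing over the three indices of the last factor by `contraction_det` leaves -6 · 168 = -1008,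
and the normalization is 1/(42 · 24) = 1/1008. -/
theorem crossVol_basis (hb : IsAdapted m b) (h : IsCross (crossMetric m) m) :
    crossVol m b = -1 := by
  have key : MultilinearMap.alternatization (crossTensor m) b = -1008 := by
    have hv : ∀ I : Fin 7 → Fin 7, (fun t => b (I t)) =
        ![b (I 0), b (I 1), b (I 2), b (I 3), b (I 4), b (I 5), b (I 6)] := by
      intro I; funext t; fin_cases t <;> rfl
    rw [alternatization_basis]
    simp only [sum_fin_succ_fun, Finset.univ_unique, Finset.sum_singleton]
    calc _ = ∑ p, ∑ q, ∑ r, ∑ s,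
          ((∑ a, gramCoeff a a * tripleCoeff p q a * tripleCoeff r s a : ℤ) : ℝ) *
          ∑ i, ∑ j, ∑ k, tripleCoeff i j k * b.det ![b i, b j, b k, b p, b q, b r, b s] := by
          simp only [Finset.mul_sum]
          refine Finset.sum_congr rfl fun p _ => Finset.sum_congr rfl fun q _ =>
            Finset.sum_congr rfl fun r _ => Finset.sum_congr rfl fun s _ =>
            Finset.sum_congr rfl fun i _ => Finset.sum_congr rfl fun j _ =>
            Finset.sum_congr rfl fun k _ => ?_
          rw [← alternating_rotate_four b.det, ← basis_det_comp b,
            ← hb.metric_cross_cross h, ← hb.triple]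
          rw [hv]
          change b.det ![b p, b q, b r, b s, b i, b j, b k] *
            (crossMetric m (m (b p) (b q)) (m (b r) (b s)) *
            crossMetric m (m (b i) (b j)) (b k)) = _
          ring
      _ = ∑ p, ∑ q, ∑ r, ∑ s,
          ((∑ a, gramCoeff a a * tripleCoeff p q a * tripleCoeff r s a : ℤ) : ℝ) *
          (-6 * fourCoeff p q r s) := by
          simp only [hb.contraction_det h, hb.crossFour_basis h]
      _ = -6 * ((∑ p, ∑ q, ∑ r, ∑ s,
          (∑ a, gramCoeff a a * tripleCoeff p q a * tripleCoeff r s a) * fourCoeff p q r s : ℤ) :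
            ℝ) := by
          push_cast
          simp only [Finset.mul_sum]
          refine Finset.sum_congr rfl fun p _ => Finset.sum_congr rfl fun q _ =>
            Finset.sum_congr rfl fun r _ => Finset.sum_congr rfl fun s _ => by ring
      _ = -1008 := by
          rw [sum_fourCoeff]
          norm_num
  rw [crossVol, AlternatingMap.smul_apply, key]
  norm_num

theorem eq_neg_det {ω : V [⋀^Fin 7]→ₗ[ℝ] ℝ} (hω : ω b = -1) : ω = -b.det := by
  have e := ω.eq_smul_basis_det b
  rw [hω] at e
  rw [e]
  ext v
  simp

theorem crossVol_eq (hb : IsAdapted m b) (h : IsCross (crossMetric m) m) :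
    crossVol m = -b.det :=
  eq_neg_det (hb.crossVol_basis h)

theorem hodgeStarThree_apply [FiniteDimensional ℝ V] (hb : IsAdapted m b)
    (h : IsCross (crossMetric m) m) {ω : V [⋀^Fin 7]→ₗ[ℝ] ℝ} (hω : ω = -b.det)
    (β : V [⋀^Fin 3]→ₗ[ℝ] ℝ) (hβ : ∀ x y z, β ![x, y, z] = crossMetric m (m x y) z) (x y z w : V) :
    hodgeStarThree (crossMetric m) ω β ![x, y, z, w] =
      crossFour (crossMetric m) m x y z w := by
  have e : hodgeStarThree (crossMetric m) ω β ![x, y, z, w] = (1 / 6 : ℝ) *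
      ∑ i, ∑ j, ∑ k, β ![raisedBasis (crossMetric m) (Module.finBasis ℝ V) i,
        raisedBasis (crossMetric m) (Module.finBasis ℝ V) j,
        raisedBasis (crossMetric m) (Module.finBasis ℝ V) k] *
        ω ![Module.finBasis ℝ V i, Module.finBasis ℝ V j, Module.finBasis ℝ V k,
          x, y, z, w] := by
    simp only [hodgeStarThree, alternating_sum_apply, AlternatingMap.smul_apply, hook_apply,
      smul_eq_mul]
  rw [e, sum_dual_family_three (hb.nondegenerate h) (Module.finBasis ℝ V) _
    (raisedBasis_dual (hb.nondegenerate h) _) b _ hb.dual, hω]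
  have e2 : ∀ i j k : Fin 7, β ![(gramCoeff i i : ℝ) • b i, (gramCoeff j j : ℝ) • b j,
      (gramCoeff k k : ℝ) • b k] = tripleCoeff i j k := by
    intro i j k
    rw [hβ, ← gramCoeff_mul_tripleCoeff]
    simp only [map_smul, LinearMap.smul_apply, hb.triple, smul_eq_mul]
    push_cast
    ring
  simp only [e2, AlternatingMap.neg_apply, mul_neg, Finset.sum_neg_distrib]
  rw [hb.contraction_det h]
  ring

end IsAdapted

end

/-! ### Compatible structures as forms of non-null spinors -/

namespace G2Structure

variable {V : Type*} [AddCommGroup V] [Module ℝ V]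

theorem isCross [FiniteDimensional ℝ V] (hV : Module.finrank ℝ V = 7) (Φ : G2Structure V) :
    IsCross Φ.metric Φ.cross := Φ.isSplit.isCross hV

theorem vol_comp [FiniteDimensional ℝ V] (hV : Module.finrank ℝ V = 7) (Φ : G2Structure V)
    (f : V ≃ₗ[ℝ] V) (v : Fin 7 → V) :
    Φ.vol (fun i => f (v i)) = LinearMap.det (f : V →ₗ[ℝ] V) * Φ.vol v := by
  obtain ⟨b, hb⟩ := Φ.isSplit.exists_isAdapted hV
  rw [vol, hb.crossVol_eq (Φ.isCross hV)]
  simp only [AlternatingMap.neg_apply, mul_neg, neg_inj]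
  exact b.det_comp (f : V →ₗ[ℝ] V) v

theorem form_tuple (Φ : G2Structure V) (v : Fin 3 → V) :
    Φ.form v = Φ.metric (Φ.cross (v 0) (v 1)) (v 2) := by
  rw [metric, ← Φ.form_apply]
  congr 1
  funext i
  fin_cases i <;> rfl

theorem formI_apply (Φ : G2Structure V) (S x y z : V) :
    Φ.formI S ![x, y, z] = Φ.metric S S * Φ.metric (Φ.cross x y) z
      - Φ.metric S x * Φ.metric (Φ.cross S y) z + Φ.metric S y * Φ.metric (Φ.cross S x) z
      - Φ.metric S z * Φ.metric (Φ.cross S x) y := by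
  rw [formI, hook_apply, wedgeOne, AlternatingMap.alternatizeUncurryFin_apply, Fin.sum_univ_four]
  simp only [LinearMap.smulRight_apply, AlternatingMap.smul_apply, form_tuple]
  simp [Fin.removeNth, Fin.succAbove, Fin.lt_def, pow_succ]
  ring

theorem formJ_apply [FiniteDimensional ℝ V] (hV : Module.finrank ℝ V = 7) (Φ : G2Structure V)
    (S x y z : V) : Φ.formJ S ![x, y, z] = crossFour Φ.metric Φ.cross S x y z := by
  obtain ⟨b, hb⟩ := Φ.isSplit.exists_isAdapted hV
  exact hb.hodgeStarThree_apply (Φ.isCross hV) (hb.crossVol_eq (Φ.isCross hV)) Φ.form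
    Φ.form_apply S x y z

theorem form_ext {ω ω' : V [⋀^Fin 3]→ₗ[ℝ] ℝ} (h : ∀ x y z, ω ![x, y, z] = ω' ![x, y, z]) :
    ω = ω' := by
  ext v
  have : v = ![v 0, v 1, v 2] := by funext i; fin_cases i <;> rfl
  rw [this, h]

/-- The three-form of the spinor `(a, r S)` in terms of `Φ`, `Φ_I` and `Φ_J`. -/
theorem spinForm_eq_form [FiniteDimensional ℝ V] (hV : Module.finrank ℝ V = 7)
    (Φ : G2Structure V) (a r : ℝ) (S : V) (hN : a ^ 2 + r ^ 2 * Φ.metric S S ≠ 0) (x y z : V) :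
    spinForm Φ.metric Φ.cross (a, r • S) x y z =
      (Φ.form + (-2 * r ^ 2 / (a ^ 2 + r ^ 2 * Φ.metric S S)) • Φ.formI S
        + (-2 * a * r / (a ^ 2 + r ^ 2 * Φ.metric S S)) • Φ.formJ S) ![x, y, z] := by
  have e : Φ.metric (r • S) (r • S) = r ^ 2 * Φ.metric S S := by simp; ring
  rw [(Φ.isCross hV).spinForm_eq a (r • S) (by rwa [e]), e]
  simp only [AlternatingMap.add_apply, AlternatingMap.smul_apply, formI_apply, formJ_apply hV,
    form_tuple, smul_eq_mul, crossFour, map_smul, LinearMap.smul_apply]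
  simp only [Matrix.cons_val]
  ring

/-- The pullback of a `G₂`-structure along a linear automorphism. -/
noncomputable def pullback (Φ : G2Structure V) (f : V ≃ₗ[ℝ] V) : G2Structure V where
  form := Φ.form.compLinearMap f
  cross := (Φ.cross.compl₁₂ (f : V →ₗ[ℝ] V) (f : V →ₗ[ℝ] V)).compr₂ (f.symm : V →ₗ[ℝ] V)
  isSplit := by
    obtain ⟨A, hA⟩ := Φ.isSplit
    exact ⟨A.trans f.symm, fun x y => by simp [hA]⟩
  form_apply x y z := by
    rw [← crossMetric_conj f (m' := Φ.cross) (by simp)]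
    simp [form_tuple, metric]

theorem apply_pullback_cross (Φ : G2Structure V) (f : V ≃ₗ[ℝ] V) (x y : V) :
    f ((Φ.pullback f).cross x y) = Φ.cross (f x) (f y) := by
  simp [pullback]

theorem sameMetricOrientation_pullback [FiniteDimensional ℝ V] (hV : Module.finrank ℝ V = 7)
    (Φ : G2Structure V) (f : V ≃ₗ[ℝ] V)
    (hf : ∀ x y, Φ.metric (f x) (f y) = Φ.metric x y)
    (hdet : 0 < LinearMap.det (f : V →ₗ[ℝ] V)) : Φ.SameMetricOrientation (Φ.pullback f) := by
  refine ⟨?_, _, hdet, ?_⟩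
  · ext x y
    rw [← hf x y, metric, metric, crossMetric_conj f (Φ.apply_pullback_cross f)]
  · ext v
    rw [AlternatingMap.smul_apply, smul_eq_mul, ← vol_comp hV, vol, vol,
      crossVol_conj f (Φ.apply_pullback_cross f)]

theorem exists_normalizing (Φ : G2Structure V) (S : V) :
    ∃ c : ℝ, 0 < c ∧ -Φ.metric (c • S) (c • S) ∈ ({-1, 0, 1} : Set ℝ) := by
  by_cases h : Φ.metric S S = 0
  · exact ⟨1, one_pos, by simp [h]⟩
  · have hpos : 0 < |Φ.metric S S| := abs_pos.2 h
    refine ⟨(√|Φ.metric S S|)⁻¹, inv_pos.2 (Real.sqrt_pos.2 hpos), ?_⟩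
    have e : Φ.metric ((√|Φ.metric S S|)⁻¹ • S) ((√|Φ.metric S S|)⁻¹ • S) =
        Φ.metric S S / |Φ.metric S S| := by
      simp only [map_smul, LinearMap.smul_apply, smul_eq_mul]
      rw [← mul_assoc, ← mul_inv, Real.mul_self_sqrt hpos.le, div_eq_inv_mul]
    rw [e]
    rcases lt_or_gt_of_ne h with h' | h'
    · rw [abs_of_neg h', div_neg, div_self h]; simp
    · rw [abs_of_pos h', div_self h]; simp

/-- The hyperplane orthogonal to a vector contains a non-null vector. -/
theorem exists_nonnull_orthogonal [FiniteDimensional ℝ V] (hV : Module.finrank ℝ V = 7)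
    (Φ : G2Structure V) (S : V) : ∃ v, Φ.metric v v ≠ 0 ∧ Φ.metric v S = 0 := by
  obtain ⟨b, hb⟩ := Φ.isSplit.exists_isAdapted hV
  by_cases h0 : Φ.metric (b 0) S = 0
  · exact ⟨b 0, hb.nonnull 0, h0⟩
  -- `b 0` and `b 1` span a positive definite plane, which meets the hyperplane orthogonal to `S` in
  -- a nonzero vector.
  · refine ⟨Φ.metric (b 1) S • b 0 - Φ.metric (b 0) S • b 1, ?_, ?_⟩
    · have g : ∀ i j, Φ.metric (b i) (b j) = gramCoeff i j := hb.gram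
      have g0 : gramCoeff 0 0 = 1 := by decide
      have g1 : gramCoeff 1 1 = 1 := by decide
      have g01 : gramCoeff 0 1 = 0 := by decide
      have g10 : gramCoeff 1 0 = 0 := by decide
      simp only [map_sub, map_smul, LinearMap.sub_apply, LinearMap.smul_apply, smul_eq_mul, g, g0,
        g1, g01, g10]
      have := sq_pos_of_ne_zero h0
      push_cast
      nlinarith [sq_nonneg (Φ.metric (b 1) S)]
    · simp only [map_sub, map_smul, LinearMap.sub_apply, LinearMap.smul_apply, smul_eq_mul]
      ring

/-- The three-form of a non-null spinor is that of a compatible `G₂`-structure. -/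
theorem exists_form_eq_spinForm [FiniteDimensional ℝ V] (hV : Module.finrank ℝ V = 7)
    (Φ : G2Structure V) (a : ℝ) (S : V) (hN : a ^ 2 + Φ.metric S S ≠ 0) :
    ∃ Φ' : G2Structure V, Φ.SameMetricOrientation Φ' ∧
      ∀ x y z, Φ'.form ![x, y, z] = spinForm Φ.metric Φ.cross (a, S) x y z := by
  have h := Φ.isCross hV
  obtain ⟨v, hv, hvS⟩ := Φ.exists_nonnull_orthogonal hV S
  obtain ⟨w, hw, hvw⟩ := h.exists_cliffordMul_cliffordMul a S v hv hvS hN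
  -- The reflection in w is applied last: pulling back then turns (1, 0) into w·(1, 0), and next
  -- into v·w·(1, 0).
  let f := (hyperplaneReflection Φ.metric v hv).trans (hyperplaneReflection Φ.metric w hw)
  refine ⟨Φ.pullback f, Φ.sameMetricOrientation_pullback hV f (fun x y => ?_) ?_,
    fun x y z => ?_⟩
  · simp only [f, LinearEquiv.trans_apply, hyperplaneReflection_isometry h.symm]
  · rw [LinearEquiv.coe_trans, LinearMap.det_comp, det_hyperplaneReflection,
      det_hyperplaneReflection]
    norm_num
  · have e : (Φ.pullback f).form ![x, y, z] = Φ.metric (Φ.cross (f x) (f y)) (f z) := by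
      simp [pullback, form_tuple]
    rw [e, ← h.spinForm_one, ← hvw]
    simp only [f, LinearEquiv.trans_apply]
    rw [h.spinForm_hyperplaneReflection w hw, h.spinForm_hyperplaneReflection v hv, neg_neg]

/-- Compatible `G₂`-structures have the three-form of a non-null spinor. -/
theorem SameMetricOrientation.exists_spinForm [FiniteDimensional ℝ V]
    (hV : Module.finrank ℝ V = 7) {Φ Φ' : G2Structure V} (hΦ : Φ.SameMetricOrientation Φ') :
    ∃ u : ℝ × V, spinInner Φ.metric u u ≠ 0 ∧
      ∀ x y z, Φ'.form ![x, y, z] = spinForm Φ.metric Φ.cross u x y z := by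
  have h := Φ.isCross hV
  obtain ⟨hmet, c, hc, hvol⟩ := hΦ
  obtain ⟨A, hA⟩ := Φ.isSplit
  obtain ⟨A', hA'⟩ := Φ'.isSplit
  obtain ⟨b, hb⟩ := Φ.isSplit.exists_isAdapted hV
  let g : V ≃ₗ[ℝ] V := A.symm.trans A'
  have hg : ∀ x y, g (Φ.cross x y) = Φ'.cross (g x) (g y) := by
    intro x y
    obtain ⟨x, rfl⟩ := A.surjective x
    obtain ⟨y, rfl⟩ := A.surjective y
    simp [g, ← hA, hA']
  have hiso : ∀ x y, Φ.metric (g x) (g y) = Φ.metric x y := by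
    intro x y
    conv_lhs => rw [← hmet]
    exact crossMetric_conj g hg x y
  -- Naturality of the volume form gives Φ'.vol(g b) = Φ.vol(b), while Φ'.vol = c Φ.vol scales by
  -- det g.
  have hdet : c * LinearMap.det (g : V →ₗ[ℝ] V) = 1 := by
    have e1 : Φ'.vol (fun i => g (b i)) = Φ.vol b := crossVol_conj g hg b
    have e2 : Φ.vol b = -1 := hb.crossVol_basis h
    rw [hvol, AlternatingMap.smul_apply, vol_comp hV, e2, smul_eq_mul] at e1
    linarith
  have hiso' : ∀ x y, Φ.metric (g.symm x) (g.symm y) = Φ.metric x y := by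
    intro x y
    rw [← hiso, g.apply_symm_apply, g.apply_symm_apply]
  -- The inverse of g is used because Φ' is the pullback of Φ along it; positivity of c then
  -- excludes the sign -1.
  obtain ⟨s, hs, hds, hspin⟩ := h.exists_spinForm_isometry b hb.orthogonal hb.nonnull g.symm hiso'
  have hs1 : s = 1 := by
    have e : LinearMap.det (g.symm : V →ₗ[ℝ] V) * LinearMap.det (g : V →ₗ[ℝ] V) = 1 :=
      g.det_symm_mul_det
    rw [hds] at e
    rcases hs with rfl | rfl
    · rfl
    · have : LinearMap.det (g : V →ₗ[ℝ] V) = -1 := by linarith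
      rw [this] at hdet
      linarith
  obtain ⟨u, hu, huf⟩ := hspin (1, 0) (by simp [spinInner_apply])
  refine ⟨u, hu, fun x y z => ?_⟩
  have e := huf x y z
  rw [hs1, one_mul, h.spinForm_one, ← hiso, hg, ← hmet] at e
  rw [← hmet, ← e, form_tuple]
  simp

end G2Structure

/-! ### Parametrization of the conics: a circle, a parabola and a two-branched hyperbola -/

theorem one_parameter_spacelike (A B : ℝ) : -(-1 : ℝ) * A ^ 2 + 2 * A + B ^ 2 = 0 ↔
    ∃ t : ℝ, A = Real.cos t - 1 ∧ B = Real.sin t := by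
  constructor
  · intro h
    have hn : ‖(⟨A + 1, B⟩ : ℂ)‖ = 1 := by
      rw [Complex.norm_def, Real.sqrt_eq_one, Complex.normSq_mk]
      linarith
    refine ⟨Complex.arg ⟨A + 1, B⟩, ?_, ?_⟩
    · have := Complex.norm_mul_cos_arg ⟨A + 1, B⟩
      rw [hn, one_mul] at this
      rw [this]; ring
    · have := Complex.norm_mul_sin_arg ⟨A + 1, B⟩
      rw [hn, one_mul] at this
      rw [this]
  · rintro ⟨t, rfl, rfl⟩
    linarith [Real.sin_sq_add_cos_sq t]

theorem one_parameter_null (A B : ℝ) : -(0 : ℝ) * A ^ 2 + 2 * A + B ^ 2 = 0 ↔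
    ∃ t : ℝ, A = -(1 / 2) * t ^ 2 ∧ B = t := by
  constructor
  · intro h
    exact ⟨B, by linarith, rfl⟩
  · rintro ⟨t, rfl, rfl⟩
    ring

theorem one_parameter_timelike (A B : ℝ) : -(1 : ℝ) * A ^ 2 + 2 * A + B ^ 2 = 0 ↔
    ∃ t : ℝ, (A = 1 - Real.cosh t ∨ A = 1 + Real.cosh t) ∧ B = Real.sinh t := by
  constructor
  · intro h
    refine ⟨Real.arsinh B, ?_, (Real.sinh_arsinh B).symm⟩
    have e := Real.cosh_sq (Real.arsinh B)
    rw [Real.sinh_arsinh] at e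
    have : (A - 1 + Real.cosh (Real.arsinh B)) * (A - 1 - Real.cosh (Real.arsinh B)) = 0 := by
      linarith
    rcases mul_eq_zero.1 this with h' | h'
    · left; linarith
    · right; linarith
  · rintro ⟨t, rfl | rfl, rfl⟩ <;> linarith [Real.cosh_sq t]

theorem proposition4p1 {V : Type*} [AddCommGroup V] [Module ℝ V] [FiniteDimensional ℝ V]
    (hV : Module.finrank ℝ V = 7) (Φ : G2Structure V) :
    -- every nonzero vector can be normalized by a positive factor
    (∀ S : V, S ≠ 0 → ∃ c : ℝ, 0 < c ∧
      -Φ.metric (c • S) (c • S) ∈ ({-1, 0, 1} : Set ℝ)) ∧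
    -- every admissible pair gives a compatible structure
    (∀ S : V, S ≠ 0 → ∀ ε : ℝ, ε = -Φ.metric S S → ε ∈ ({-1, 0, 1} : Set ℝ) →
      ∀ A B : ℝ, -ε * A ^ 2 + 2 * A + B ^ 2 = 0 →
        ∃ Φ' : G2Structure V,
          Φ'.form = Φ.form + A • Φ.formI S + B • Φ.formJ S ∧ Φ.SameMetricOrientation Φ') ∧
    -- the admissible pairs form one-parameter families
    (∀ A B : ℝ, -(-1 : ℝ) * A ^ 2 + 2 * A + B ^ 2 = 0 ↔
      ∃ t : ℝ, A = Real.cos t - 1 ∧ B = Real.sin t) ∧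
    (∀ A B : ℝ, -(0 : ℝ) * A ^ 2 + 2 * A + B ^ 2 = 0 ↔
      ∃ t : ℝ, A = -(1 / 2) * t ^ 2 ∧ B = t) ∧
    (∀ A B : ℝ, -(1 : ℝ) * A ^ 2 + 2 * A + B ^ 2 = 0 ↔
      ∃ t : ℝ, (A = 1 - Real.cosh t ∨ A = 1 + Real.cosh t) ∧ B = Real.sinh t) ∧
    -- every compatible structure arises in this way
    (∀ Φ' : G2Structure V, Φ.SameMetricOrientation Φ' →
      ∃ S : V, S ≠ 0 ∧ ∃ ε : ℝ, ε = -Φ.metric S S ∧ ε ∈ ({-1, 0, 1} : Set ℝ) ∧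
        ∃ A B : ℝ, -ε * A ^ 2 + 2 * A + B ^ 2 = 0 ∧
          Φ'.form = Φ.form + A • Φ.formI S + B • Φ.formJ S) := by
  refine ⟨fun S _ => Φ.exists_normalizing S, ?_, one_parameter_spacelike, one_parameter_null,
    one_parameter_timelike, ?_⟩
  · rintro S - ε hε - A B hAB
    by_cases hA : A = 0
    · have hB : B = 0 := by
        rw [hA] at hAB
        exact pow_eq_zero_iff two_ne_zero |>.1 (by linarith)
      exact ⟨Φ, by simp [hA, hB], rfl, 1, one_pos, by simp⟩
    -- The spinor (a, S) of norm N has coefficients -2/N and -2a/N; matching them with A and B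
    -- forces a = B/A and N = -2/A.
    · have hN : (B / A) ^ 2 + Φ.metric S S = -2 / A := by
        have hH : Φ.metric S S = -ε := by rw [hε, neg_neg]
        rw [hH]
        field_simp
        linarith
      have hN0 : (B / A) ^ 2 + Φ.metric S S ≠ 0 := by
        rw [hN]
        exact div_ne_zero (by norm_num) hA
      obtain ⟨Φ', hΦ', hform⟩ := Φ.exists_form_eq_spinForm hV (B / A) S hN0
      refine ⟨Φ', G2Structure.form_ext fun x y z => ?_, hΦ'⟩
      have e := Φ.spinForm_eq_form hV (B / A) 1 S (by simpa using hN0) x y z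
      rw [one_smul, one_pow, one_mul, hN] at e
      rw [hform, e]
      congr 5
      · field_simp
      · field_simp
  · intro Φ' hΦ'
    obtain ⟨⟨a, s⟩, hu, hform⟩ := hΦ'.exists_spinForm hV
    have hN : a ^ 2 + Φ.metric s s ≠ 0 := by
      simpa [spinInner_apply, sq] using hu
    by_cases hs : s = 0
    -- A purely scalar spinor gives Φ' = Φ, so any normalized vector works with A = B = 0.
    · have : Nontrivial V := Module.nontrivial_of_finrank_pos (R := ℝ) (by omega)
      obtain ⟨S, hS⟩ := exists_ne (0 : V)
      obtain ⟨c, hc, hcS⟩ := Φ.exists_normalizing S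
      refine ⟨c • S, smul_ne_zero hc.ne' hS, _, rfl, hcS, 0, 0, by ring,
        G2Structure.form_ext fun x y z => ?_⟩
      have ha : a ^ 2 ≠ 0 := by simpa [hs] using hN
      have e := Φ.spinForm_eq_form hV a 0 0 (by simpa using ha) x y z
      rw [smul_zero] at e
      rw [hform, hs, e]
      simp
    · obtain ⟨c, hc, hcs⟩ := Φ.exists_normalizing s
      -- The normalized vector is S = c s, and the factor r = c⁻¹ is absorbed into the coefficients.
      have hsc : s = c⁻¹ • (c • s) := by rw [inv_smul_smul₀ hc.ne']
      have hss : Φ.metric s s = c⁻¹ ^ 2 * Φ.metric (c • s) (c • s) := by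
        conv_lhs => rw [hsc]
        simp only [map_smul, LinearMap.smul_apply, smul_eq_mul]
        ring
      rw [hss] at hN
      refine ⟨c • s, smul_ne_zero hc.ne' hs, _, rfl, hcs,
        -2 * c⁻¹ ^ 2 / (a ^ 2 + c⁻¹ ^ 2 * Φ.metric (c • s) (c • s)),
        -2 * a * c⁻¹ / (a ^ 2 + c⁻¹ ^ 2 * Φ.metric (c • s) (c • s)), ?_,
        G2Structure.form_ext fun x y z => ?_⟩
      · generalize Φ.metric (c • s) (c • s) = q at hN ⊢
        generalize c⁻¹ = r at hN ⊢
        field_simp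
        ring
      · rw [hform, ← Φ.spinForm_eq_form hV a c⁻¹ (c • s) hN, ← hsc]
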